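/- Let $(X,\mu)$ be a standard probability space and let $\mathcal R\subseteq X\times X$ be a countable Borel equivalence relation which is p.m.p., i.e. $\mu(\mathrm{dom}\,\varphi)=\mu(\mathrm{rng}\,\varphi)$ for every Borel bijection $\varphi$ between Borel subsets of $X$ whose graph is contained in $\mathcal R$, and aperiodic, i.e. $\mu$-almost every $\mathcal R$-class is infinite. Equip $\mathcal R$ with the left measure $M(A)=\int_X |\{y : (x,y)\in A\}|\,d\mu(x)$. Then there is a Borel probability measure on $\mathcal R$ with the same null sets as $M$. For any such measure $m$, let $\mathrm{MAlg}(\mathcal R,M)$ be the set of Borel subsets of $\mathcal R$ modulo $M$-null symmetric difference, with the metric $d_m(A,B)=m(A\bigtriangleup B)$; let $\mathrm{Sub}(\mathcal R)\subseteq\mathrm{MAlg}(\mathcal R,M)$ be the set of those elements that are represented by a Borel equivalence relation on $X$, with the induced topology (the strong topology); and let $\mathrm{Sub}_{\mathrm{fin}}(\mathcal R)\subseteq\mathrm{Sub}(\mathcal R)$ be the set of those elements that are represented by a Borel equivalence relation all of whose classes are finite. Then $\mathrm{Sub}_{\mathrm{fin}}(\mathcal R)$ is $F_{\sigma\delta}$-complete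 in $\mathrm{Sub}(\mathcal R)$: it is an $F_{\sigma\delta}$ subset (a countable intersection of countable unions of closed sets), and it is $F_{\sigma\delta}$-hard, i.e. for every zero-dimensional Polish space $Y$ and every $F_{\sigma\delta}$ set $B\subseteq Y$ there is a continuous map $f:Y\to\mathrm{Sub}(\mathcal R)$ with $f^{-1}(\mathrm{Sub}_{\mathrm{fin}}(\mathcal R))=B$. -/

import Mathlib

open Set MeasureTheory
open scoped ENNReal

universe u v

/-! ### The class `F_σδ`, hardness and completeness -/

/-- `A` is `F_σδ`: a countable intersection of countable unions of closed sets. -/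
def IsFSigmaDelta {Z : Type u} [TopologicalSpace Z] (A : Set Z) : Prop :=
  ∃ C : ℕ → ℕ → Set Z, (∀ n k, IsClosed (C n k)) ∧ A = ⋂ n, ⋃ k, C n k

/-- `A ⊆ Z` is `F_σδ`-hard: every `F_σδ` subset `B` of a zero-dimensional Polish space `Y`
(one with a basis of clopen sets) is the preimage of `A` under some continuous map `Y → Z`. -/
def IsFSigmaDeltaHard {Z : Type u} [TopologicalSpace Z] (A : Set Z) : Prop :=
  ∀ (Y : Type v) [TopologicalSpace Y] [PolishSpace Y],
    TopologicalSpace.IsTopologicalBasis {U : Set Y | IsClopen U} →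
    ∀ B : Set Y, IsFSigmaDelta B → ∃ f : Y → Z, Continuous f ∧ f ⁻¹' A = B

/-- `A ⊆ Z` is `F_σδ`-complete: it is `F_σδ` and `F_σδ`-hard. -/
def IsFSigmaDeltaComplete {Z : Type u} [TopologicalSpace Z] (A : Set Z) : Prop :=
  IsFSigmaDelta A ∧ IsFSigmaDeltaHard.{u, v} A

/-! ### Countable Borel equivalence relations -/

section EquivalenceRelations

variable {X : Type u} [MeasurableSpace X]

/-- `R ⊆ X × X` is a countable Borel equivalence relation. -/
structure IsCBER (R : Set (X × X)) : Prop where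
  measurableSet : MeasurableSet R
  equivalence : Equivalence fun x y => (x, y) ∈ R
  countable_class : ∀ x, {y | (x, y) ∈ R}.Countable

/-- `R` preserves `μ`: every element of the Borel pseudo full group of `R`, that is, every
injective Borel map `φ : A → X` on a Borel set `A` with graph contained in `R`, satisfies
`μ (rng φ) = μ (dom φ)`. (A Borel map on `A` is the restriction of a Borel map on `X`.) -/
def PreservesMeasure (R : Set (X × X)) (μ : Measure X) : Prop :=
  ∀ (A : Set X) (φ : X → X), MeasurableSet A → Measurable φ → InjOn φ A →
    (∀ x ∈ A, (x, φ x) ∈ R) → μ (φ '' A) = μ A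

/-- `R` is aperiodic: almost all its classes are infinite. -/
def IsAperiodic (R : Set (X × X)) (μ : Measure X) : Prop :=
  ∀ᵐ x ∂μ, {y | (x, y) ∈ R}.Infinite

/-- The section `A_x = {y | (x, y) ∈ A}` of a subset `A` of `R`. -/
def fiber {R : Set (X × X)} (A : Set R) (x : X) : Set X :=
  {y | (x, y) ∈ Subtype.val '' A}

/-- The left measure `M(A) = ∫ |A_x| dμ(x)` of a Borel subset `A` of `R`. -/
noncomputable def leftMeasure {R : Set (X × X)} (μ : Measure X) (A : Set R) : ℝ≥0∞ :=
  ∫⁻ x, ((fiber A x).encard : ℝ≥0∞) ∂μ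

/-- `m` is a probability measure on `R` which is equivalent to the left measure `M`: the two have
the same null Borel sets. -/
structure IsEquivalentProbability {R : Set (X × X)} (μ : Measure X) (m : Measure R) : Prop where
  isProbabilityMeasure : IsProbabilityMeasure m
  null_iff : ∀ A : Set R, MeasurableSet A → (m A = 0 ↔ leftMeasure μ A = 0)

/-- The measure algebra of `(R, m)`: Borel subsets of `R` up to null symmetric difference, with
the distance `d_m(A, B) = m (A ∆ B)` and its topology. -/
abbrev MAlg {R : Set (X × X)} (m : Measure R) : Type u := SeparationQuotient (MeasuredSets m)

/-- The subset `A` of `R` is an equivalence relation on `X`. -/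
def IsSubequivalence {R : Set (X × X)} (A : Set R) : Prop :=
  Equivalence fun x y => y ∈ fiber A x

/-- The space `Sub(R)` of subequivalence relations of `R`: the elements of the measure algebra
represented by a Borel equivalence relation. Its subspace topology is the strong topology. -/
def SubRel {R : Set (X × X)} (m : Measure R) : Set (MAlg m) :=
  {a | ∃ S : MeasuredSets m, SeparationQuotient.mk S = a ∧ IsSubequivalence (S : Set R)}

/-- The set `Sub_fin(R)` of finite subequivalence relations of `R`, inside `Sub(R)`: those
represented by a Borel equivalence relation all of whose classes are finite. -/
def SubRelFin {R : Set (X × X)} (m : Measure R) : Set (SubRel m) :=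
  {a | ∃ S : MeasuredSets m, SeparationQuotient.mk S = (a : MAlg m) ∧
    IsSubequivalence (S : Set R) ∧ ∀ x, (fiber (S : Set R) x).Finite}

end EquivalenceRelations

/-! ### Analytic sets are universally measurable -/

section Analytic

open Filter Topology

/-! Everything rests on an almost-everywhere Lusin–Novikov theorem (`IsCBER.exists_enumeration`):
Borel maps `g n` with graphs in `R` that enumerate almost every class. They show that a Borel set is
`m`-null iff almost all its fibres are empty, that saturations of null sets are null, and that an
almost everywhere finite relation has an everywhere finite representative.

Upper bound: count each point of a fibre at its first index in the enumeration. Almost all fibres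
are finite iff for every `k` there is `N` such that the set of `x` whose fibre contains a point of
first index at least `N` has measure at most `1/(k+1)`. For fixed `k` and `N` this is a closed
condition on the relation, because it reduces to finitely many indices at a time and each of these
depends continuously on the relation.

Hardness: the arrays of digits all of whose rows are finite are the model `F_σδ` set. Aperiodicity
allows repeated halving (`exists_halving`), which yields binary digits on `X` whose finite changes
stay inside `R` (`DyadicTower`). An array `c` codes a relation: on the points whose first zero digit
has index `n`, the digits in row `n` of `c` beyond `n` may be changed. Almost all its classes are
finite iff all rows are (`ae_finite_relSet_iff`), and clopen entries give a continuous map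
(`continuous_relSet`). An `F_σδ` set is encoded in the rows by `exists_isClopen_finite_iff`. -/

theorem isCompact_setOf_forall_le (n : ℕ → ℕ) : IsCompact {x : ℕ → ℕ | ∀ i, x i ≤ n i} := by
  have : {x : ℕ → ℕ | ∀ i, x i ≤ n i} = Set.univ.pi fun i => Set.Iic (n i) := by
    ext x; simp [Pi.le_def]
  rw [this]
  exact isCompact_univ_pi fun i => (Set.finite_Iic (n i)).isCompact

/-- A neighbourhood of the compact box `{x | x ≤ n}` of the Baire space contains the points
which satisfy the bound on finitely many coordinates. -/
theorem exists_forall_le_subset_of_isOpen {n : ℕ → ℕ} {V : Set (ℕ → ℕ)} (hV : IsOpen V)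
    (h : {x | ∀ i, x i ≤ n i} ⊆ V) : ∃ k, {x | ∀ i < k, x i ≤ n i} ⊆ V := by
  have hopen : ∀ k, IsOpen {x : ℕ → ℕ | PiNat.cylinder x k ⊆ V} := by
    intro k
    rw [isOpen_iff_mem_nhds]
    intro x hx
    refine Filter.mem_of_superset
      ((PiNat.isOpen_cylinder (fun _ => ℕ) x k).mem_nhds (PiNat.self_mem_cylinder x k)) ?_
    intro y hy
    have : PiNat.cylinder y k = PiNat.cylinder x k := PiNat.mem_cylinder_iff_eq.1 hy
    change PiNat.cylinder y k ⊆ V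
    rw [this]; exact hx
  have hcov : {x : ℕ → ℕ | ∀ i, x i ≤ n i} ⊆ ⋃ k, {x : ℕ → ℕ | PiNat.cylinder x k ⊆ V} := by
    intro x hx
    obtain ⟨k, hk⟩ := (PiNat.isTopologicalBasis_cylinders fun _ => ℕ).mem_nhds_iff.1
      (hV.mem_nhds (h hx))
    obtain ⟨⟨y, m, rfl⟩, hxy, hm⟩ := hk
    refine mem_iUnion.2 ⟨m, ?_⟩
    change PiNat.cylinder x m ⊆ V
    rwa [PiNat.mem_cylinder_iff_eq.1 hxy]
  obtain ⟨k, hk⟩ := (isCompact_setOf_forall_le n).elim_directed_cover _ hopen hcov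
    (Monotone.directed_le fun a b hab x hx => (PiNat.cylinder_anti x hab).trans hx)
  refine ⟨k, fun x hx => ?_⟩
  have hy : (fun i => min (x i) (n i)) ∈ {x : ℕ → ℕ | ∀ i, x i ≤ n i} := fun i => min_le_right _ _
  refine hk hy ?_
  rw [PiNat.mem_cylinder_iff]
  intro i hi
  exact (min_eq_left (hx i hi)).symm

variable {X : Type*} [TopologicalSpace X] [TopologicalSpace.MetrizableSpace X] [MeasurableSpace X]
  [BorelSpace X]

/-- Continuous images of the Baire space are inner regular for compact sets. -/
theorem exists_isCompact_subset_range_lt_measure (μ : Measure X) [IsFiniteMeasure μ]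
    {f : (ℕ → ℕ) → X} (hf : Continuous f) {c : ℝ≥0∞} (hc : c < μ (range f)) :
    ∃ K ⊆ range f, IsCompact K ∧ c ≤ μ K := by
  have step : ∀ S : Set (ℕ → ℕ), c < μ (f '' S) → ∀ k, ∃ m, c < μ (f '' (S ∩ {x | x k ≤ m})) := by
    intro S hS k
    have hU : f '' S = ⋃ m, f '' (S ∩ {x | x k ≤ m}) := by
      rw [← image_iUnion, ← inter_iUnion]
      congr 1
      ext x
      simp only [mem_inter_iff, mem_iUnion, iff_self_and]
      exact fun _ => ⟨x k, le_refl (x k)⟩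
    have hmono : Monotone fun m => f '' (S ∩ {x : ℕ → ℕ | x k ≤ m}) := fun a b hab =>
      image_mono (inter_subset_inter_right _ fun x (hx : x k ≤ a) => hx.trans hab)
    rw [hU, hmono.measure_iUnion] at hS
    exact lt_iSup_iff.1 hS
  -- Bounding the coordinates one at a time keeps the measure of the image above `c`, since the
  -- bounded pieces increase to the whole set.
  choose! N hN using step
  let n' : ℕ → Set (ℕ → ℕ) := fun k => Nat.rec univ (fun k S => S ∩ {x | x k ≤ N S k}) k
  have hn' : ∀ k, c < μ (f '' n' k) := by
    intro k
    induction k with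
    | zero => simpa [n'] using hc
    | succ k ih => exact hN _ ih k
  let n : ℕ → ℕ := fun k => N (n' k) k
  have hn : ∀ k, n' k = {x | ∀ i < k, x i ≤ n i} := by
    intro k
    induction k with
    | zero => simp [n']
    | succ k ih =>
      have : n' (k + 1) = n' k ∩ {x | x k ≤ n k} := rfl
      rw [this, ih]
      ext x
      simp only [mem_inter_iff, Set.mem_ofPred_eq, Nat.lt_succ_iff_lt_or_eq]
      constructor
      · rintro ⟨h1, h2⟩ i (hi | rfl)
        exacts [h1 i hi, h2]
      · exact fun h => ⟨fun i hi => h i (Or.inl hi), h k (Or.inr rfl)⟩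
  refine ⟨f '' {x | ∀ i, x i ≤ n i}, image_subset_range _ _, (isCompact_setOf_forall_le n).image hf, ?_⟩
  let := TopologicalSpace.metrizableSpaceMetric X
  -- The limit box need not inherit the bound by continuity from above, as the images are not known
  -- to be measurable. Instead, any open set around its image contains the image of some
  -- finite-stage `n' k`.
  rw [Set.measure_eq_iInf_isOpen]
  refine le_iInf₂ fun U hU => le_iInf fun hUo => ?_
  obtain ⟨k, hk⟩ := exists_forall_le_subset_of_isOpen (hUo.preimage hf) (image_subset_iff.1 hU)
  refine (hn' k).le.trans (measure_mono ?_)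
  rw [hn k]
  exact image_subset_iff.2 hk

/-- **Lusin's theorem**: analytic sets are universally measurable. -/
theorem MeasureTheory.AnalyticSet.nullMeasurableSet {A : Set X} (hA : AnalyticSet A)
    (μ : Measure X) [IsFiniteMeasure μ] : NullMeasurableSet A μ := by
  rw [AnalyticSet] at hA
  rcases hA with rfl | ⟨f, hf, rfl⟩
  · exact MeasurableSet.empty.nullMeasurableSet
  rcases eq_or_ne (μ (range f)) 0 with h0 | h0
  · exact NullMeasurableSet.of_null h0
  obtain ⟨c, -, hc, hclim⟩ := exists_seq_strictMono_tendsto' (pos_iff_ne_zero.2 h0)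
  choose K hKs hKc hK using fun n => exists_isCompact_subset_range_lt_measure μ hf (hc n).2
  have hmeas : MeasurableSet (⋃ n, K n) := MeasurableSet.iUnion fun n => (hKc n).measurableSet
  have hsub : (⋃ n, K n) ⊆ range f := iUnion_subset hKs
  have hle : μ (range f) ≤ μ (⋃ n, K n) :=
    le_of_tendsto' hclim fun n => (hK n).trans (measure_mono (subset_iUnion K n))
  exact hmeas.nullMeasurableSet.congr
    (ae_eq_of_subset_of_measure_ge hsub hle hmeas.nullMeasurableSet (measure_ne_top _ _))

end Analytic

/-- The image of a Borel set under a Borel map of standard Borel spaces is universally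
measurable. -/
theorem MeasurableSet.nullMeasurableSet_image {E X : Type*} [MeasurableSpace E]
    [StandardBorelSpace E] [MeasurableSpace X] [StandardBorelSpace X] {f : E → X} {s : Set E}
    (hs : MeasurableSet s) (hf : Measurable f) (μ : Measure X) [IsFiniteMeasure μ] :
    NullMeasurableSet (f '' s) μ := by
  let := upgradeStandardBorel X
  exact (hs.analyticSet_image hf).nullMeasurableSet μ

/-! ### A measure-theoretic Lusin–Novikov theorem -/

section LusinNovikov

open Filter Topology

/-- A countable nonempty Polish space has an isolated point. -/
theorem exists_isOpen_singleton_of_countable (Z : Type*) [TopologicalSpace Z] [PolishSpace Z]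
    [Countable Z] [Nonempty Z] : ∃ z : Z, IsOpen ({z} : Set Z) := by
  obtain ⟨z, y, hy⟩ := nonempty_interior_of_iUnion_of_closed
    (fun z : Z => isClosed_singleton (x := z)) (iUnion_of_singleton Z)
  refine ⟨z, ?_⟩
  have h : interior {z} = {z} :=
    (subset_singleton_iff_eq.1 interior_subset).resolve_left (Set.nonempty_iff_ne_empty.1 ⟨y, hy⟩)
  exact h ▸ isOpen_interior

/-- The points having exactly one preimage in a Borel set form a universally measurable set. -/
theorem nullMeasurableSet_existsUnique_preimage {E X : Type*} [MeasurableSpace E]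
    [StandardBorelSpace E] [MeasurableSpace X] [StandardBorelSpace X] {p : E → X}
    (hp : Measurable p) {s : Set E} (hs : MeasurableSet s) (μ : Measure X) [IsFiniteMeasure μ] :
    NullMeasurableSet {x | ∃! e, e ∈ s ∧ p e = x} μ := by
  let D : Set (E × E) := {q | q.1 ∈ s ∧ q.2 ∈ s ∧ p q.1 = p q.2 ∧ q.1 ≠ q.2}
  have hD : MeasurableSet D := by
    refine (measurable_fst hs).inter ((measurable_snd hs).inter (MeasurableSet.inter ?_ ?_))
    · exact measurableSet_eq_fun (hp.comp measurable_fst) (hp.comp measurable_snd)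
    · exact (measurableSet_eq_fun measurable_fst measurable_snd).compl
  have h : {x | ∃! e, e ∈ s ∧ p e = x} = p '' s \ (fun q : E × E => p q.1) '' D := by
    ext x
    constructor
    · rintro ⟨e, ⟨he, rfl⟩, hu⟩
      refine ⟨⟨e, he, rfl⟩, ?_⟩
      rintro ⟨⟨a, b⟩, ⟨ha, hb, hab, hne⟩, hae⟩
      exact hne ((hu a ⟨ha, hae⟩).trans (hu b ⟨hb, hab.symm.trans hae⟩).symm)
    · rintro ⟨⟨e, he, rfl⟩, hx⟩
      refine ⟨e, ⟨he, rfl⟩, fun b hb => ?_⟩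
      by_contra hne
      exact hx ⟨(e, b), ⟨he, hb.1, hb.2.symm, fun h => hne h.symm⟩, rfl⟩
  rw [h]
  exact (hs.nullMeasurableSet_image hp μ).diff
    (hD.nullMeasurableSet_image (hp.comp measurable_fst) μ)

/-- The sets which are covered by countably many Borel sections of `p` and which are open in the
fibres of `p`, with respect to the basis `U`. -/
structure IsOpenSectionUnion {E X : Type*} [MeasurableSpace E] (p : E → X) (U : ℕ → Set E)
    (W : Set E) : Prop where
  measurableSet : MeasurableSet W
  exists_cover : ∃ F : ℕ → Set E, (∀ n, MeasurableSet (F n)) ∧ (∀ n, InjOn p (F n)) ∧ W ⊆ ⋃ n, F n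
  exists_basis : ∀ e ∈ W, ∃ n, e ∈ U n ∧ U n ∩ p ⁻¹' {p e} ⊆ W

theorem IsOpenSectionUnion.iUnion {E X : Type*} [MeasurableSpace E] {p : E → X} {U : ℕ → Set E}
    {W : ℕ → Set E} (h : ∀ n, IsOpenSectionUnion p U (W n)) :
    IsOpenSectionUnion p U (⋃ n, W n) where
  measurableSet := MeasurableSet.iUnion fun n => (h n).measurableSet
  exists_cover := by
    choose F hF hFi hFW using fun n => (h n).exists_cover
    refine ⟨fun k => F k.unpair.1 k.unpair.2, fun _ => hF _ _, fun _ => hFi _ _, ?_⟩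
    refine iUnion_subset fun n e he => ?_
    obtain ⟨j, hj⟩ := mem_iUnion.1 (hFW n he)
    exact mem_iUnion.2 ⟨Nat.pair n j, by simpa using hj⟩
  exists_basis := by
    intro e he
    obtain ⟨n, hn⟩ := mem_iUnion.1 he
    obtain ⟨k, hk, hkW⟩ := (h n).exists_basis e hn
    exact ⟨k, hk, hkW.trans (subset_iUnion W n)⟩

/-- A measure exhaustion replaces the transfinite Cantor–Bendixson derivative. Choose a countable
union `W` of sections, open in the fibres, that minimises the weighted measure `Φ` of what it
misses. If `W` misses part of a fibre, that part is closed, countable and nonempty, so some basic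
set isolates a point of it. Adding all points isolated in this way gives a competitor for `W`, so
minimality confines the missed fibres to a null set. -/
theorem exists_sections_of_continuous {E X : Type*} [TopologicalSpace E] [PolishSpace E]
    [MeasurableSpace E] [BorelSpace E] [TopologicalSpace X] [PolishSpace X] [MeasurableSpace X]
    [BorelSpace X] {p : E → X} (hp : Continuous p) (hc : ∀ x, (p ⁻¹' {x}).Countable)
    (μ : Measure X) [IsFiniteMeasure μ] :
    ∃ F : ℕ → Set E, (∀ n, MeasurableSet (F n)) ∧ (∀ n, InjOn p (F n)) ∧
      ∀ᵐ x ∂μ, p ⁻¹' {x} ⊆ ⋃ n, F n := by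
  obtain ⟨U, hU⟩ : ∃ U : ℕ → Set E, insert ∅ (TopologicalSpace.countableBasis E) = range U :=
    ((TopologicalSpace.countable_countableBasis E).insert _).exists_eq_range (insert_nonempty _ _)
  have hUo : ∀ n, IsOpen (U n) := by
    intro n
    have : U n ∈ insert ∅ (TopologicalSpace.countableBasis E) := hU ▸ mem_range_self n
    rcases this with h | h
    · rw [h]; exact isOpen_empty
    · exact TopologicalSpace.isOpen_of_mem_countableBasis h
  have hUb : ∀ (V : Set E) (e : E), IsOpen V → e ∈ V → ∃ n, e ∈ U n ∧ U n ⊆ V := by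
    intro V e hV he
    obtain ⟨B, hB, heB, hBV⟩ :=
      (TopologicalSpace.isBasis_countableBasis E).exists_subset_of_mem_open he hV
    have : B ∈ range U := hU ▸ mem_insert_of_mem _ hB
    obtain ⟨n, rfl⟩ := this
    exact ⟨n, heB, hBV⟩
  let Φ : Set E → ℝ≥0∞ := fun W => ∑' n, 2⁻¹ ^ n * μ (p '' (U n \ W))
  have hΦfin : ∀ W, Φ W ≠ ∞ := by
    intro W
    have : Φ W ≤ ∑' n : ℕ, 2⁻¹ ^ n * μ univ :=
      ENNReal.tsum_le_tsum fun n => by gcongr; exact subset_univ _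
    rw [ENNReal.tsum_mul_right, ENNReal.tsum_geometric] at this
    refine ne_top_of_le_ne_top (ENNReal.mul_ne_top ?_ (measure_ne_top μ _)) this
    simp
  have hΦmono : ∀ {W W'}, W ⊆ W' → Φ W' ≤ Φ W := fun h =>
    ENNReal.tsum_le_tsum fun n => by gcongr
  obtain ⟨W, hW, hWmin⟩ : ∃ W, IsOpenSectionUnion p U W ∧
      ∀ W', IsOpenSectionUnion p U W' → Φ W ≤ Φ W' := by
    have hne : (Φ '' {W | IsOpenSectionUnion p U W}).Nonempty :=
      ⟨_, ∅, ⟨MeasurableSet.empty, ⟨fun _ => ∅, fun _ => MeasurableSet.empty,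
        fun _ => injOn_empty _, empty_subset _⟩, fun e he => he.elim⟩, rfl⟩
    obtain ⟨s, -, hs, hmem⟩ := exists_seq_tendsto_sInf hne (OrderBot.bddBelow _)
    choose W hW hWs using hmem
    refine ⟨⋃ n, W n, IsOpenSectionUnion.iUnion hW, fun W' hW' => ?_⟩
    have h1 : Φ (⋃ n, W n) ≤ sInf (Φ '' {W | IsOpenSectionUnion p U W}) :=
      ge_of_tendsto' hs fun n => (hΦmono (subset_iUnion W n)).trans (hWs n).le
    exact h1.trans (sInf_le ⟨W', hW', rfl⟩)
  have hm : ∀ n, MeasurableSet (U n \ W) := fun n => (hUo n).measurableSet.diff hW.measurableSet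
  choose V' hV's hV'm hV'ae using fun n =>
    (nullMeasurableSet_existsUnique_preimage hp.measurable (hm n) μ).exists_measurable_subset_ae_eq
  -- The points that `U n` isolates in their fibre minus `W`, up to a null set of fibres: `V' n` is
  -- a Borel substitute for a set that is only universally measurable.
  let P : ℕ → Set E := fun n => (U n \ W) ∩ p ⁻¹' V' n
  have hPW : W ∪ ⋃ n, P n = W ∪ ⋃ n, U n ∩ p ⁻¹' V' n := by
    rw [union_iUnion, union_iUnion]
    refine iUnion_congr fun n => ?_
    ext e
    by_cases he : e ∈ W <;> simp [P, he]
  have hPinj : ∀ n, InjOn p (P n) := by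
    intro n a ha b hb hab
    exact (hV's n ha.2).unique ⟨ha.1, rfl⟩ ⟨hb.1, hab.symm⟩
  have hPm : ∀ n, MeasurableSet (P n) := fun n => (hm n).inter (hp.measurable (hV'm n))
  have hW' : IsOpenSectionUnion p U (W ∪ ⋃ n, P n) := by
    refine ⟨hW.measurableSet.union (MeasurableSet.iUnion hPm), ?_, ?_⟩
    · obtain ⟨F, hF, hFi, hFW⟩ := hW.exists_cover
      refine ⟨fun k => Sum.elim F P (Equiv.natSumNatEquivNat.symm k), fun k => ?_, fun k => ?_, ?_⟩
      · dsimp only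
        cases Equiv.natSumNatEquivNat.symm k
        exacts [hF _, hPm _]
      · dsimp only
        cases Equiv.natSumNatEquivNat.symm k
        exacts [hFi _, hPinj _]
      · rintro e (he | he)
        · obtain ⟨n, hn⟩ := mem_iUnion.1 (hFW he)
          exact mem_iUnion.2 ⟨Equiv.natSumNatEquivNat (Sum.inl n), by
            rw [Equiv.symm_apply_apply]; exact hn⟩
        · obtain ⟨n, hn⟩ := mem_iUnion.1 he
          exact mem_iUnion.2 ⟨Equiv.natSumNatEquivNat (Sum.inr n), by
            rw [Equiv.symm_apply_apply]; exact hn⟩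
    · rw [hPW]
      rintro e (he | he)
      · obtain ⟨n, hn, hnW⟩ := hW.exists_basis e he
        exact ⟨n, hn, hnW.trans subset_union_left⟩
      · obtain ⟨n, hn, hnV⟩ := mem_iUnion.1 he
        refine ⟨n, hn, fun a ha => Or.inr (mem_iUnion.2 ⟨n, ha.1, ?_⟩)⟩
        have : p a = p e := ha.2
        rw [mem_preimage, this]; exact hnV
  have hterm : ∀ n, μ (p '' (U n \ W)) ≤ μ (p '' (U n \ (W ∪ ⋃ n, P n))) := by
    intro n
    by_contra hlt
    rw [not_le] at hlt
    refine (hWmin _ hW').not_gt (ENNReal.tsum_lt_tsum (i := n) (hΦfin _) (fun k => ?_) ?_)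
    · gcongr
      exact subset_union_left
    · exact ENNReal.mul_lt_mul_right (by simp) (by simp) hlt
  have hae : ∀ n, (p '' (U n \ (W ∪ ⋃ n, P n)) : Set X) =ᵐ[μ] p '' (U n \ W) := fun n =>
    ae_eq_of_subset_of_measure_ge (image_mono (sdiff_subset_sdiff_right subset_union_left))
      (hterm n) (((hUo n).measurableSet.diff hW'.measurableSet).nullMeasurableSet_image
        hp.measurable μ) (measure_ne_top _ _)
  obtain ⟨F, hF, hFi, hFW⟩ := hW.exists_cover
  refine ⟨F, hF, hFi, ?_⟩
  have hae' := ae_all_iff.2 fun n => Filter.eventuallyEq_set.1 (hae n)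
  have hVae' := ae_all_iff.2 fun n => Filter.eventuallyEq_set.1 (hV'ae n)
  filter_upwards [hae', hVae'] with x hx hxV
  refine Subset.trans ?_ hFW
  by_contra hsub
  let Z : Set E := p ⁻¹' {x} \ W
  have hZne : Z.Nonempty := not_subset.1 hsub
  have hZcl : IsClosed Z := by
    rw [← isOpen_compl_iff, isOpen_iff_forall_mem_open]
    intro e he
    by_cases hex : p e = x
    · have heW : e ∈ W := by
        by_contra h
        exact he ⟨hex, h⟩
      obtain ⟨n, hn, hnW⟩ := hW.exists_basis e heW
      refine ⟨U n, fun a ha hZ => hZ.2 (hnW ⟨ha, ?_⟩), hUo n, hn⟩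
      have : p a = x := hZ.1
      exact this.trans hex.symm
    · exact ⟨(p ⁻¹' {x})ᶜ, fun a ha hZ => ha hZ.1, (isClosed_singleton.preimage hp).isOpen_compl,
        hex⟩
  have : PolishSpace Z := hZcl.polishSpace
  have : Countable Z := ((hc x).mono sdiff_subset).to_subtype
  have : Nonempty Z := hZne.to_subtype
  obtain ⟨⟨z, hz⟩, hzo⟩ := exists_isOpen_singleton_of_countable Z
  obtain ⟨O, hO, hOz⟩ := isOpen_induced_iff.1 hzo
  have hzO : z ∈ O := by
    have : (⟨z, hz⟩ : Z) ∈ Subtype.val ⁻¹' O := hOz ▸ mem_singleton _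
    exact this
  obtain ⟨n, hzn, hnO⟩ := hUb O z hO hzO
  have huniq : ∀ e ∈ U n \ W, p e = x → e = z := by
    intro e he hex
    have : (⟨e, hex, he.2⟩ : Z) ∈ Subtype.val ⁻¹' O := hnO he.1
    rw [hOz] at this
    exact congrArg Subtype.val (mem_singleton_iff.1 this)
  have hxVn : x ∈ V' n := (hxV n).2 ⟨z, ⟨⟨hzn, hz.2⟩, hz.1⟩, fun e he => huniq e he.1 he.2⟩
  obtain ⟨e, he, hex⟩ := (hx n).2 ⟨z, ⟨hzn, hz.2⟩, hz.1⟩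
  refine he.2 (Or.inr (mem_iUnion.2 ⟨n, ⟨he.1, fun h => he.2 (Or.inl h)⟩, ?_⟩))
  rw [mem_preimage, hex]
  exact hxVn

/-- A countable-to-one Borel map `p` has, up to a null set of fibres, a countable cover of its
domain by Borel sets on which it is injective. -/
theorem exists_sections {E X : Type*} [MeasurableSpace E] [StandardBorelSpace E]
    [MeasurableSpace X] [StandardBorelSpace X] {p : E → X} (hp : Measurable p)
    (hc : ∀ x, (p ⁻¹' {x}).Countable) (μ : Measure X) [IsFiniteMeasure μ] :
    ∃ F : ℕ → Set E, (∀ n, MeasurableSet (F n)) ∧ (∀ n, InjOn p (F n)) ∧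
      ∀ᵐ x ∂μ, p ⁻¹' {x} ⊆ ⋃ n, F n := by
  let := upgradeStandardBorel X
  let tE := upgradeStandardBorel E
  -- A finer Polish topology with the same Borel sets makes `p` continuous.
  obtain ⟨t, hle, hpt, ht⟩ := hp.exists_continuous
  let := t
  have : BorelSpace E := ⟨by
    exact (eq_borel_upgradeStandardBorel E).trans (borel_eq_borel_of_le ht tE.toPolishSpace hle).symm⟩
  exact exists_sections_of_continuous hpt hc μ

/-- A Borel map inverting an injective Borel map `p` on a Borel set `F`. -/
theorem exists_measurable_leftInverse {E X : Type*} [MeasurableSpace E] [StandardBorelSpace E]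
    [MeasurableSpace X] [StandardBorelSpace X] {p : E → X} (hp : Measurable p) {s : X → E}
    (hs : Measurable s) {F : Set E} (hF : MeasurableSet F) (hi : InjOn p F) :
    ∃ g : X → E, Measurable g ∧ (∀ e ∈ F, g (p e) = e) ∧ ∀ x ∉ p '' F, g x = s x := by
  classical
  let g : X → E := fun x => if h : ∃ e ∈ F, p e = x then h.choose else s x
  have hgF : ∀ e ∈ F, g (p e) = e := by
    intro e he
    have h : ∃ e' ∈ F, p e' = p e := ⟨e, he, rfl⟩
    simp only [g, dif_pos h]
    exact hi h.choose_spec.1 he h.choose_spec.2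
  have hgs : ∀ x ∉ p '' F, g x = s x := by
    intro x hx
    exact dif_neg hx
  refine ⟨g, fun S hS => ?_, hgF, hgs⟩
  have : g ⁻¹' S = p '' (F ∩ S) ∪ (s ⁻¹' S \ p '' F) := by
    ext x
    by_cases hx : x ∈ p '' F
    · obtain ⟨e, he, rfl⟩ := hx
      have h2 : p e ∈ p '' F := ⟨e, he, rfl⟩
      simp only [mem_preimage, hgF e he, mem_union, Set.mem_sdiff, h2, not_true, and_false, or_false]
      constructor
      · exact fun h => ⟨e, ⟨he, h⟩, rfl⟩
      · rintro ⟨a, ⟨ha, haS⟩, hae⟩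
        rwa [← hi ha he hae]
    · simp only [mem_preimage, hgs x hx, mem_union, Set.mem_sdiff, hx, not_false_eq_true, and_true]
      constructor
      · exact Or.inr
      · rintro (⟨a, ha, rfl⟩ | h)
        · exact (hx ⟨a, ha.1, rfl⟩).elim
        · exact h
  rw [this]
  exact ((hF.inter hS).image_of_measurable_injOn hp (hi.mono inter_subset_left)).union
    ((hs hS).diff (hF.image_of_measurable_injOn hp hi))

end LusinNovikov

/-! ### Enumerations of a countable Borel equivalence relation -/

section Enumeration

variable {X : Type u} [MeasurableSpace X] {R : Set (X × X)} {μ : Measure X}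

theorem IsCBER.refl (hR : IsCBER R) (x : X) : (x, x) ∈ R := hR.equivalence.refl x

theorem IsCBER.symm (hR : IsCBER R) {x y : X} (h : (x, y) ∈ R) : (y, x) ∈ R :=
  hR.equivalence.symm h

theorem IsCBER.trans (hR : IsCBER R) {x y z : X} (h : (x, y) ∈ R) (h' : (y, z) ∈ R) :
    (x, z) ∈ R := hR.equivalence.trans h h'

variable [StandardBorelSpace X]

/-- Almost every class of a countable Borel equivalence relation is enumerated by a sequence of
Borel maps. -/
theorem IsCBER.exists_enumeration (hR : IsCBER R) (μ : Measure X) [IsFiniteMeasure μ] :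
    ∃ g : ℕ → X → X, (∀ n, Measurable (g n)) ∧ (∀ n x, (x, g n x) ∈ R) ∧
      ∀ᵐ x ∂μ, ∀ y, (x, y) ∈ R → ∃ n, g n x = y := by
  have := hR.measurableSet.standardBorel
  let p : R → X := fun r => r.1.1
  have hp : Measurable p := measurable_fst.comp measurable_subtype_coe
  have hc : ∀ x, (p ⁻¹' {x}).Countable := by
    intro x
    refine MapsTo.countable_of_injOn (f := fun r : R => r.1.2) (t := {y | (x, y) ∈ R}) ?_ ?_
      (hR.countable_class x)
    · rintro ⟨⟨a, b⟩, hab⟩ rfl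
      exact hab
    · rintro ⟨⟨a, b⟩, hab⟩ rfl ⟨⟨a', b'⟩, hab'⟩ h1 h2
      exact Subtype.ext (Prod.ext (Eq.symm h1) h2)
  obtain ⟨F, hF, hFi, hFc⟩ := exists_sections hp hc μ
  -- The diagonal is the default value off the sections, so that each `g n` has its graph in `R`
  -- everywhere.
  let s : X → R := fun x => ⟨(x, x), hR.refl x⟩
  have hs : Measurable s := (measurable_id.prodMk measurable_id).subtype_mk
  choose G hG hGF hGs using fun n => exists_measurable_leftInverse hp hs (hF n) (hFi n)
  refine ⟨fun n x => (G n x).1.2, fun n => (measurable_snd.comp measurable_subtype_coe).comp (hG n),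
    fun n x => ?_, ?_⟩
  · have h1 : (G n x).1.1 = x := by
      by_cases hx : x ∈ p '' F n
      · obtain ⟨e, he, rfl⟩ := hx
        rw [hGF n e he]
      · rw [hGs n x hx]
    have h2 := (G n x).2
    rw [← Prod.mk.eta (p := (G n x).1), h1] at h2
    exact h2
  · filter_upwards [hFc] with x hx y hy
    obtain ⟨n, hn⟩ := mem_iUnion.1 (hx (show (⟨(x, y), hy⟩ : R) ∈ p ⁻¹' {x} from rfl))
    exact ⟨n, congrArg (fun r : R => r.1.2) (hGF n _ hn)⟩

/-- The saturation of a null set is null. -/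
theorem PreservesMeasure.measure_saturation_eq_zero [IsFiniteMeasure μ] (hR : IsCBER R)
    (hpmp : PreservesMeasure R μ) {N : Set X} (hN : μ N = 0) :
    μ {x | ∃ y ∈ N, (x, y) ∈ R} = 0 := by
  obtain ⟨g, hg, hgR, hgc⟩ := hR.exists_enumeration μ
  -- The class of `g n x` must be enumerated from `g n x` for almost every `x`. Enumerating for the
  -- image measure ensures this before `g n` is known to respect null sets. Some `h n m` then
  -- recovers `x`, so `g n` is injective on `P n m`.
  choose h hh hhR hhc using fun n => hR.exists_enumeration (μ.map (g n))
  have hinv := ae_all_iff.2 fun n => ae_of_ae_map (hg n).aemeasurable (hhc n)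
  let P : ℕ → ℕ → Set X := fun n m => {x | h n m (g n x) = x} ∩ g n ⁻¹' toMeasurable μ N
  have hP : ∀ n m, μ (P n m) = 0 := by
    intro n m
    have hPm : MeasurableSet (P n m) :=
      (measurableSet_eq_fun ((hh n m).comp (hg n)) measurable_id).inter
        (hg n (measurableSet_toMeasurable μ N))
    have hinj : InjOn (g n) (P n m) := by
      intro a ha b hb hab
      rw [← show h n m (g n a) = a from ha.1, ← show h n m (g n b) = b from hb.1, hab]
    rw [← hpmp (P n m) (g n) hPm (hg n) hinj fun x _ => hgR n x]
    refine measure_mono_null (t := toMeasurable μ N) ?_ (by rwa [measure_toMeasurable])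
    rintro _ ⟨x, hx, rfl⟩
    exact hx.2
  have hPU : μ (⋃ n, ⋃ m, P n m) = 0 :=
    measure_iUnion_null fun n => measure_iUnion_null fun m => hP n m
  refine measure_mono_null_ae ?_ hPU
  filter_upwards [hgc, hinv] with x hx hxi
  rintro ⟨y, hyN, hxy⟩
  obtain ⟨n, rfl⟩ := hx y hxy
  obtain ⟨m, hm⟩ := hxi n x (hR.symm hxy)
  exact mem_iUnion₂.2 ⟨n, m, hm, subset_toMeasurable μ N hyN⟩

/-- Every null set is contained in an invariant Borel null set. -/
theorem PreservesMeasure.exists_invariant_null [IsFiniteMeasure μ] (hR : IsCBER R)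
    (hpmp : PreservesMeasure R μ) {N : Set X} (hN : μ N = 0) :
    ∃ N', N ⊆ N' ∧ MeasurableSet N' ∧ μ N' = 0 ∧ ∀ x y, (x, y) ∈ R → x ∈ N' → y ∈ N' := by
  let Q : ℕ → Set X := fun k =>
    Nat.rec (toMeasurable μ N) (fun _ S => toMeasurable μ {x | ∃ y ∈ S, (x, y) ∈ R}) k
  have hQ : ∀ k, MeasurableSet (Q k) ∧ μ (Q k) = 0 := by
    intro k
    induction k with
    | zero => exact ⟨measurableSet_toMeasurable _ _, (measure_toMeasurable N).trans hN⟩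
    | succ k ih =>
      exact ⟨measurableSet_toMeasurable _ _, (measure_toMeasurable _).trans
        (hpmp.measure_saturation_eq_zero hR ih.2)⟩
  refine ⟨⋃ k, Q k, (subset_toMeasurable μ N).trans (subset_iUnion Q 0),
    MeasurableSet.iUnion fun k => (hQ k).1, measure_iUnion_null fun k => (hQ k).2, ?_⟩
  intro x y hxy hx
  obtain ⟨k, hk⟩ := mem_iUnion.1 hx
  exact mem_iUnion.2 ⟨k + 1, subset_toMeasurable μ _ ⟨x, hk, hR.symm hxy⟩⟩

/-- If a property holds almost everywhere, then it holds almost everywhere on the whole class. -/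
theorem PreservesMeasure.ae_forall_class [IsFiniteMeasure μ] (hR : IsCBER R)
    (hpmp : PreservesMeasure R μ) {q : X → Prop} (hq : ∀ᵐ x ∂μ, q x) :
    ∀ᵐ x ∂μ, ∀ y, (x, y) ∈ R → q y := by
  have h := hpmp.measure_saturation_eq_zero hR (ae_iff.1 hq)
  refine measure_mono_null ?_ h
  intro x hx
  simp only [mem_compl_iff, Set.mem_ofPred_eq, not_forall] at hx
  obtain ⟨y, hxy, hy⟩ := hx
  exact ⟨y, hy, hxy⟩

end Enumeration

/-! ### Probability measures equivalent to the left measure -/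

section EquivalentProbability

variable {X : Type u} {R : Set (X × X)}

theorem mem_fiber {A : Set R} {x y : X} : y ∈ fiber A x ↔ ∃ h : (x, y) ∈ R, ⟨(x, y), h⟩ ∈ A := by
  simp [fiber]

variable [MeasurableSpace X] {μ : Measure X}

theorem leftMeasure_eq_zero_iff [StandardBorelSpace X] [IsFiniteMeasure μ] (hR : IsCBER R)
    {A : Set R} (hA : MeasurableSet A) : leftMeasure μ A = 0 ↔ ∀ᵐ x ∂μ, fiber A x = ∅ := by
  obtain ⟨g, hg, hgR, hgc⟩ := hR.exists_enumeration μ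
  constructor
  · intro h
    let G : ℕ → X → R := fun n x => ⟨(x, g n x), hgR n x⟩
    have hG : ∀ n, Measurable (G n) := fun n => (measurable_id.prodMk (hg n)).subtype_mk
    have h0 : ∀ n, μ (G n ⁻¹' A) = 0 := by
      intro n
      rw [← le_zero_iff, ← h, ← lintegral_indicator_one (hG n hA)]
      refine lintegral_mono fun x => ?_
      by_cases hx : x ∈ G n ⁻¹' A
      · rw [indicator_of_mem hx]
        have : 1 ≤ (fiber A x).encard :=
          one_le_encard_iff_nonempty.2 ⟨g n x, mem_fiber.2 ⟨hgR n x, hx⟩⟩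
        rw [Pi.one_apply, ← ENat.toENNReal_one]
        exact ENat.toENNReal_le.2 this
      · rw [indicator_of_notMem hx]
        exact zero_le
    have h1 : ∀ᵐ x ∂μ, ∀ n, x ∉ G n ⁻¹' A := ae_all_iff.2 fun n => measure_eq_zero_iff_ae_notMem.1 (h0 n)
    filter_upwards [h1, hgc] with x hx hxc
    refine eq_empty_of_forall_notMem fun y hy => ?_
    obtain ⟨hxy, hyA⟩ := mem_fiber.1 hy
    obtain ⟨n, rfl⟩ := hxc y hxy
    exact hx n hyA
  · intro h
    rw [leftMeasure, lintegral_congr_ae (g := fun _ => 0), lintegral_zero]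
    filter_upwards [h] with x hx
    simp [hx]

/-- Push `μ` to the graph of each `g n` and sum with weights `2⁻¹ ^ (n + 1)`; these graphs exhaust
almost every fibre. -/
theorem exists_isEquivalentProbability [StandardBorelSpace X] [IsProbabilityMeasure μ]
    (hR : IsCBER R) : ∃ m : Measure R, IsEquivalentProbability μ m := by
  obtain ⟨g, hg, hgR, hgc⟩ := hR.exists_enumeration μ
  let G : ℕ → X → R := fun n x => ⟨(x, g n x), hgR n x⟩
  have hG : ∀ n, Measurable (G n) := fun n => (measurable_id.prodMk (hg n)).subtype_mk
  let m : Measure R := Measure.sum fun n => (2⁻¹ : ℝ≥0∞) ^ (n + 1) • μ.map (G n)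
  refine ⟨m, ⟨⟨?_⟩, fun A hA => ?_⟩⟩
  · simp only [m, Measure.sum_apply _ MeasurableSet.univ, Measure.smul_apply, smul_eq_mul,
      Measure.map_apply (hG _) MeasurableSet.univ, preimage_univ, measure_univ, mul_one]
    rw [ENNReal.tsum_geometric_add_one, ENNReal.one_sub_inv_two, inv_inv]
    exact ENNReal.inv_mul_cancel (by simp) (by simp)
  · rw [leftMeasure_eq_zero_iff hR hA]
    simp only [m, Measure.sum_apply _ hA, Measure.smul_apply, smul_eq_mul,
      Measure.map_apply (hG _) hA, ENNReal.tsum_eq_zero, mul_eq_zero]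
    constructor
    · intro h
      have h1 : ∀ᵐ x ∂μ, ∀ n, x ∉ G n ⁻¹' A := ae_all_iff.2 fun n =>
        measure_eq_zero_iff_ae_notMem.1 ((h n).resolve_left (by simp))
      filter_upwards [h1, hgc] with x hx hxc
      refine eq_empty_of_forall_notMem fun y hy => ?_
      obtain ⟨hxy, hyA⟩ := mem_fiber.1 hy
      obtain ⟨n, rfl⟩ := hxc y hxy
      exact hx n hyA
    · intro h n
      right
      rw [measure_eq_zero_iff_ae_notMem]
      filter_upwards [h] with x hx hxA
      have : g n x ∈ fiber A x := mem_fiber.2 ⟨hgR n x, hxA⟩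
      rw [hx] at this
      exact this

theorem IsEquivalentProbability.measure_eq_zero_iff [StandardBorelSpace X] [IsFiniteMeasure μ]
    {m : Measure R} (hm : IsEquivalentProbability μ m) (hR : IsCBER R) {A : Set R}
    (hA : MeasurableSet A) : m A = 0 ↔ ∀ᵐ x ∂μ, fiber A x = ∅ :=
  (hm.null_iff A hA).trans (leftMeasure_eq_zero_iff hR hA)

end EquivalentProbability

/-! ### The upper bound -/

/-! ### Topology of the measure algebra -/

section MeasureAlgebra

open Filter Topology
open scoped symmDiff

/-- The density of `ν` is integrable, so its integral over a set is small once the `m`-measure of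
the set is. -/
theorem tendsto_measure_symmDiff_of_absolutelyContinuous {α : Type*} [MeasurableSpace α]
    {m ν : Measure α} [IsFiniteMeasure m] [IsFiniteMeasure ν] (h : ν ≪ m) (S : MeasuredSets m) :
    Tendsto (fun S' : MeasuredSets m => ν ((S' : Set α) ∆ S)) (𝓝 S) (𝓝 0) := by
  rw [ENNReal.tendsto_nhds_zero]
  intro ε hε
  obtain ⟨δ, hδ, hδε⟩ := exists_pos_setLIntegral_lt_of_measure_lt
    (Measure.lintegral_rnDeriv_lt_top ν m).ne hε.ne'
  filter_upwards [Metric.eball_mem_nhds S hδ] with S' hS'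
  have := hδε _ hS'
  rw [Measure.setLIntegral_rnDeriv h] at this
  exact this.le

theorem MeasureTheory.MeasuredSets.measurableSet {α : Type*} [MeasurableSpace α] {m : Measure α}
    (S : MeasuredSets m) : MeasurableSet (S : Set α) := S.2

theorem mk_eq_mk_iff_measure_symmDiff {α : Type*} [MeasurableSpace α] {m : Measure α}
    {S S' : MeasuredSets m} :
    SeparationQuotient.mk S = SeparationQuotient.mk S' ↔ m ((S : Set α) ∆ S') = 0 := by
  rw [SeparationQuotient.mk_eq_mk, EMetric.inseparable_iff]
  rfl

/-- A closed set of measurable sets is closed in the measure algebra. -/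
theorem isClosed_setOf_forall_mk_eq {α : Type*} [TopologicalSpace α] {C : Set α}
    (hC : IsClosed C) : IsClosed {a | ∀ S : α, SeparationQuotient.mk S = a → S ∈ C} := by
  rw [← SeparationQuotient.isQuotientMap_mk.isClosed_preimage]
  convert hC using 1
  ext S
  constructor
  · exact fun h => h S rfl
  · intro h S' hS'
    exact ((SeparationQuotient.mk_eq_mk.1 hS').mem_closed_iff hC).2 h

end MeasureAlgebra

/-! ### Finiteness of almost every class as an `F_σδ` condition -/

section UpperBound

open Filter Topology
open scoped symmDiff

variable {X : Type u} {R : Set (X × X)}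

/-- The points `x` such that `g n x` is an element of the fibre `A_x` which is not one of the
`g i x` with `i < n`. -/
def newFiberPoints (g : ℕ → X → X) (hg : ∀ n x, (x, g n x) ∈ R) (A : Set R) (n : ℕ) : Set X :=
  {x | ∀ i < n, g i x ≠ g n x} ∩ (fun x => (⟨(x, g n x), hg n x⟩ : R)) ⁻¹' A

/-- Indexing each point of the fibre by its first occurrence is a bijection with the set of `n` for
which `x` is a new fibre point. -/
theorem infinite_fiber_iff {g : ℕ → X → X} {hg : ∀ n x, (x, g n x) ∈ R} {A : Set R} {x : X}
    (hx : ∀ y, (x, y) ∈ R → ∃ n, g n x = y) :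
    (fiber A x).Infinite ↔ ∀ N, ∃ n, N ≤ n ∧ x ∈ newFiberPoints g hg A n := by
  classical
  have h1 : fiber A x = (fun n => g n x) '' {n | x ∈ newFiberPoints g hg A n} := by
    ext y
    constructor
    · intro hy
      obtain ⟨hxy, hyA⟩ := mem_fiber.1 hy
      have hn := Nat.find_spec (hx y hxy)
      refine ⟨Nat.find (hx y hxy), ⟨fun i hi h => Nat.find_min (hx y hxy) hi (h.trans hn), ?_⟩, hn⟩
      simpa only [mem_preimage, hn] using hyA
    · rintro ⟨n, hn, rfl⟩
      exact mem_fiber.2 ⟨hg n x, hn.2⟩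
  have h2 : InjOn (fun n => g n x) {n | x ∈ newFiberPoints g hg A n} := by
    intro a ha b hb hab
    rcases lt_trichotomy a b with h | h | h
    · exact (hb.1 a h hab).elim
    · exact h
    · exact (ha.1 b h hab.symm).elim
  rw [h1, infinite_image_iff h2, ← Nat.frequently_atTop_iff_infinite, frequently_atTop]

variable [MeasurableSpace X]

theorem measurableSet_newFiberPoints [MeasurableEq X] {g : ℕ → X → X} (hgm : ∀ n, Measurable (g n))
    (hg : ∀ n x, (x, g n x) ∈ R) {A : Set R} (hA : MeasurableSet A) (n : ℕ) :
    MeasurableSet (newFiberPoints g hg A n) := by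
  refine MeasurableSet.inter ?_ ((measurable_id.prodMk (hgm n)).subtype_mk hA)
  have : {x | ∀ i < n, g i x ≠ g n x} = ⋂ i, ⋂ (_ : i < n), {x | g i x = g n x}ᶜ := by
    ext x; simp
  rw [this]
  exact MeasurableSet.iInter fun i => MeasurableSet.iInter fun _ =>
    (measurableSet_eq_fun (hgm i) (hgm n)).compl

variable {μ : Measure X} [IsProbabilityMeasure μ] {m : Measure R}

/-- Replacing `S` by `S'` changes the `n`-th set only inside `G n ⁻¹' (S' ∆ S)`, whose measure tends
to zero because the image of `μ` under `G n` is absolutely continuous with respect to `m`.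
Finiteness of `I` allows these errors to be summed. -/
theorem isClosed_setOf_measure_newFiberPoints_le [StandardBorelSpace X] {g : ℕ → X → X}
    (hgm : ∀ n, Measurable (g n)) (hg : ∀ n x, (x, g n x) ∈ R)
    (hR : IsCBER R) (hm : IsEquivalentProbability μ m) (I : Finset ℕ) (c : ℝ≥0∞) :
    IsClosed {S : MeasuredSets m | μ (⋃ n ∈ I, newFiberPoints g hg (S : Set R) n) ≤ c} := by
  have := hm.isProbabilityMeasure
  let G : ℕ → X → R := fun n x => ⟨(x, g n x), hg n x⟩
  have hG : ∀ n, Measurable (G n) := fun n => (measurable_id.prodMk (hgm n)).subtype_mk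
  have hac : ∀ n, μ.map (G n) ≪ m := by
    intro n
    refine Measure.AbsolutelyContinuous.mk fun A hA hA0 => ?_
    rw [Measure.map_apply (hG n) hA, measure_eq_zero_iff_ae_notMem]
    filter_upwards [(hm.measure_eq_zero_iff hR hA).1 hA0] with x hx hxA
    have : g n x ∈ fiber A x := mem_fiber.2 ⟨hg n x, hxA⟩
    rw [hx] at this
    exact this
  refine isClosed_iff_clusterPt.2 fun S hS => ?_
  have htend : Tendsto (fun S' : MeasuredSets m => c + ∑ n ∈ I, μ.map (G n) ((S' : Set R) ∆ S))
      (𝓝 S ⊓ 𝓟 {S : MeasuredSets m | μ (⋃ n ∈ I, newFiberPoints g hg (S : Set R) n) ≤ c})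
      (𝓝 c) := by
    have h0 := tendsto_finsetSum I fun n _ =>
      tendsto_measure_symmDiff_of_absolutelyContinuous (hac n) S
    have h1 := (tendsto_const_nhds (x := c)).add h0
    simp only [Finset.sum_const_zero, add_zero] at h1
    exact h1.mono_left inf_le_left
  have : NeBot (𝓝 S ⊓ 𝓟 {S : MeasuredSets m |
    μ (⋃ n ∈ I, newFiberPoints g hg (S : Set R) n) ≤ c}) := hS
  refine ge_of_tendsto htend ?_
  filter_upwards [mem_inf_of_right (mem_principal_self _)] with S' hS'
  have hsub : (⋃ n ∈ I, newFiberPoints g hg (S : Set R) n) ⊆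
      (⋃ n ∈ I, newFiberPoints g hg (S' : Set R) n) ∪ ⋃ n ∈ I, G n ⁻¹' ((S' : Set R) ∆ S) := by
    intro x hx
    obtain ⟨n, hn, hxn⟩ := mem_iUnion₂.1 hx
    by_cases h : G n x ∈ (S' : Set R)
    · exact Or.inl (mem_iUnion₂.2 ⟨n, hn, hxn.1, h⟩)
    · exact Or.inr (mem_iUnion₂.2 ⟨n, hn, Or.inr ⟨hxn.2, h⟩⟩)
  refine (measure_mono hsub).trans ((measure_union_le _ _).trans (add_le_add hS' ?_))
  refine (measure_biUnion_finset_le _ _).trans (Finset.sum_le_sum fun n _ => ?_)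
  rw [Measure.map_apply (hG n) (S'.measurableSet.symmDiff S.measurableSet)]

theorem ae_finite_fiber_iff [MeasurableEq X] {g : ℕ → X → X} (hgm : ∀ n, Measurable (g n))
    (hg : ∀ n x, (x, g n x) ∈ R) (hgc : ∀ᵐ x ∂μ, ∀ y, (x, y) ∈ R → ∃ n, g n x = y)
    {A : Set R} (hA : MeasurableSet A) :
    (∀ᵐ x ∂μ, (fiber A x).Finite) ↔
      ∀ k : ℕ, ∃ N, μ (⋃ n ∈ Ici N, newFiberPoints g hg A n) ≤ ((k : ℝ≥0∞) + 1)⁻¹ := by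
  let T : ℕ → Set X := fun N => ⋃ n ∈ Ici N, newFiberPoints g hg A n
  have hT : ∀ x, (∀ y, (x, y) ∈ R → ∃ n, g n x = y) → ((fiber A x).Finite ↔ x ∉ ⋂ N, T N) := by
    intro x hx
    rw [← not_infinite, infinite_fiber_iff (hg := hg) hx]
    simp [T]
  have hiff : (∀ᵐ x ∂μ, (fiber A x).Finite) ↔ μ (⋂ N, T N) = 0 := by
    rw [measure_eq_zero_iff_ae_notMem]
    exact eventually_congr (hgc.mono hT)
  rw [hiff]
  have hanti : Antitone T := fun a b hab => biUnion_subset_biUnion_left (Ici_subset_Ici.2 hab)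
  have hmeas : ∀ N, MeasurableSet (T N) := fun N =>
    MeasurableSet.biUnion (to_countable _) fun n _ => measurableSet_newFiberPoints hgm hg hA n
  constructor
  · intro h0 k
    have := tendsto_measure_iInter_atTop (μ := μ) (fun N => (hmeas N).nullMeasurableSet) hanti
      ⟨0, measure_ne_top _ _⟩
    rw [h0] at this
    exact (ENNReal.tendsto_nhds_zero.1 this _ (by simp)).exists
  · intro h
    have hlim : Tendsto (fun k : ℕ => ((k : ℝ≥0∞) + 1)⁻¹) atTop (𝓝 0) := by
      have := (tendsto_add_atTop_iff_nat 1).2 ENNReal.tendsto_inv_nat_nhds_zero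
      simpa using this
    refine le_zero_iff.1 (ge_of_tendsto' hlim fun k => ?_)
    obtain ⟨N, hN⟩ := h k
    exact (measure_mono (iInter_subset T N)).trans hN

theorem IsEquivalentProbability.ae_fiber_eq [StandardBorelSpace X] (hR : IsCBER R)
    (hm : IsEquivalentProbability μ m) {S S' : MeasuredSets m}
    (h : SeparationQuotient.mk S = SeparationQuotient.mk S') :
    ∀ᵐ x ∂μ, fiber (S : Set R) x = fiber (S' : Set R) x := by
  rw [mk_eq_mk_iff_measure_symmDiff, hm.measure_eq_zero_iff hR (S.measurableSet.symmDiff S'.measurableSet)] at h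
  filter_upwards [h] with x hx
  ext y
  have hy : y ∉ fiber ((S : Set R) ∆ S') x := by rw [hx]; exact notMem_empty y
  by_cases hxy : (x, y) ∈ R
  · simp only [mem_fiber, hxy, exists_true_left, Set.mem_symmDiff] at hy ⊢
    tauto
  · simp [mem_fiber, hxy]

/-- A subequivalence relation which is almost everywhere finite is finite after modification on a
null set. -/
theorem exists_finite_representative [StandardBorelSpace X] (hR : IsCBER R)
    (hpmp : PreservesMeasure R μ) (hm : IsEquivalentProbability μ m) {S : MeasuredSets m}
    (hS : IsSubequivalence (S : Set R)) (hfin : ∀ᵐ x ∂μ, (fiber (S : Set R) x).Finite) :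
    ∃ S' : MeasuredSets m, SeparationQuotient.mk S' = SeparationQuotient.mk S ∧
      IsSubequivalence (S' : Set R) ∧ ∀ x, (fiber (S' : Set R) x).Finite := by
  obtain ⟨N, hN, hNm, hN0, hNinv⟩ := hpmp.exists_invariant_null hR (ae_iff.1 hfin)
  -- On the null set `N` the relation becomes equality. Invariance of `N` keeps the result an
  -- equivalence relation.
  let A : Set R := {r | r ∈ (S : Set R) ∧ (r.1.1 ∉ N ∨ r.1.1 = r.1.2)}
  have hp1 : Measurable fun r : R => r.1.1 := measurable_fst.comp measurable_subtype_coe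
  have hp2 : Measurable fun r : R => r.1.2 := measurable_snd.comp measurable_subtype_coe
  have hA : MeasurableSet A :=
    S.measurableSet.inter ((hp1 hNm).compl.union (measurableSet_eq_fun hp1 hp2))
  have hfib : ∀ x y, y ∈ fiber A x ↔ y ∈ fiber (S : Set R) x ∧ (x ∉ N ∨ x = y) := by
    intro x y
    rw [mem_fiber, mem_fiber]
    constructor
    · rintro ⟨h, h1, h2⟩
      exact ⟨⟨h, h1⟩, h2⟩
    · rintro ⟨⟨h, h1⟩, h2⟩
      exact ⟨h, h1, h2⟩
  have hinv : ∀ {x y}, y ∈ fiber (S : Set R) x → x ∉ N → y ∉ N := fun hxy hx hy =>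
    hx (hNinv _ _ (hR.symm (mem_fiber.1 hxy).1) hy)
  refine ⟨⟨A, hA⟩, ?_, ⟨?_, ?_, ?_⟩, fun x => ?_⟩
  · refine mk_eq_mk_iff_measure_symmDiff.2 ?_
    have h0 : m {r : R | r.1.1 ∈ N} = 0 := by
      refine (hm.measure_eq_zero_iff hR (hp1 hNm)).2 ?_
      filter_upwards [measure_eq_zero_iff_ae_notMem.1 hN0] with x hx
      refine eq_empty_of_forall_notMem fun y hy => hx ?_
      exact (mem_fiber.1 hy).2
    refine measure_mono_null ?_ h0
    rintro r (⟨h1, h2⟩ | ⟨h1, h2⟩)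
    · exact (h2 h1.1).elim
    · by_contra hr
      exact h2 ⟨h1, Or.inl hr⟩
  · exact fun x => (hfib x x).2 ⟨hS.refl x, Or.inr rfl⟩
  · intro x y hxy
    obtain ⟨h1, h2⟩ := (hfib x y).1 hxy
    exact (hfib y x).2 ⟨hS.symm h1, h2.imp (hinv h1) Eq.symm⟩
  · intro x y z hxy hyz
    obtain ⟨h1, h2⟩ := (hfib x y).1 hxy
    obtain ⟨h3, h4⟩ := (hfib y z).1 hyz
    refine (hfib x z).2 ⟨hS.trans h1 h3, ?_⟩
    rcases h2 with h2 | rfl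
    exacts [Or.inl h2, h4]
  · by_cases hx : x ∈ N
    · refine (finite_singleton x).subset fun y hy => ?_
      exact ((((hfib x y).1 hy).2).resolve_left (not_not.2 hx)).symm
    · have : (fiber (S : Set R) x).Finite := by
        by_contra h
        exact hx (hN h)
      exact this.subset fun y hy => ((hfib x y).1 hy).1

theorem mem_subRelFin_iff [StandardBorelSpace X] (hR : IsCBER R)
    (hpmp : PreservesMeasure R μ) (hm : IsEquivalentProbability μ m) {S : MeasuredSets m}
    (hS : IsSubequivalence (S : Set R)) {a : SubRel m}
    (ha : SeparationQuotient.mk S = (a : MAlg m)) :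
    a ∈ SubRelFin m ↔ ∀ᵐ x ∂μ, (fiber (S : Set R) x).Finite := by
  constructor
  · rintro ⟨S', hS', -, hfin⟩
    filter_upwards [hm.ae_fiber_eq hR (ha.trans hS'.symm)] with x hx
    rw [hx]
    exact hfin x
  · intro h
    obtain ⟨S', h1, h2, h3⟩ := exists_finite_representative hR hpmp hm hS h
    exact ⟨S', h1.trans ha, h2, h3⟩

theorem isFSigmaDelta_subRelFin [StandardBorelSpace X] (hR : IsCBER R)
    (hpmp : PreservesMeasure R μ) (hm : IsEquivalentProbability μ m) :
    IsFSigmaDelta (SubRelFin m) := by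
  obtain ⟨g, hgm, hg, hgc⟩ := hR.exists_enumeration μ
  refine ⟨fun k N => {a | ∀ S : MeasuredSets m, SeparationQuotient.mk S = (a : MAlg m) →
    S ∈ ⋂ I : Finset ℕ, ⋂ (_ : ∀ n ∈ I, N ≤ n), {S : MeasuredSets m |
      μ (⋃ n ∈ I, newFiberPoints g hg (S : Set R) n) ≤ ((k : ℝ≥0∞) + 1)⁻¹}},
    fun k N => ?_, ?_⟩
  · exact (isClosed_setOf_forall_mk_eq (isClosed_iInter fun I => isClosed_iInter fun _ =>
      isClosed_setOf_measure_newFiberPoints_le hgm hg hR hm I _)).preimage continuous_subtype_val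
  -- Closedness is available only for finite unions; continuity from below recovers the tail.
  · have key : ∀ (A : Set R) (N : ℕ) (c : ℝ≥0∞), μ (⋃ n ∈ Ici N, newFiberPoints g hg A n) ≤ c ↔
        ∀ I : Finset ℕ, (∀ n ∈ I, N ≤ n) → μ (⋃ n ∈ I, newFiberPoints g hg A n) ≤ c := by
      intro A N c
      constructor
      · intro h I hI
        exact (measure_mono (biUnion_subset_biUnion_left hI)).trans h
      · intro h
        have hU : (⋃ n ∈ Ici N, newFiberPoints g hg A n) =
            ⋃ k, ⋃ n ∈ Finset.Ico N k, newFiberPoints g hg A n := by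
          ext x
          simp only [mem_iUnion, mem_Ici, Finset.mem_Ico, exists_prop]
          constructor
          · rintro ⟨n, hn, hx⟩
            exact ⟨n + 1, n, ⟨hn, n.lt_succ_self⟩, hx⟩
          · rintro ⟨k, n, hn, hx⟩
            exact ⟨n, hn.1, hx⟩
        have hmono : Monotone fun k => ⋃ n ∈ Finset.Ico N k, newFiberPoints g hg A n :=
          fun a b hab => biUnion_subset_biUnion_left fun n hn =>
            Finset.mem_coe.1 (Finset.Ico_subset_Ico_right hab hn)
        rw [hU, hmono.measure_iUnion]
        exact iSup_le fun k => h _ fun n hn => (Finset.mem_Ico.1 hn).1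
    ext a
    obtain ⟨S, hSa, hS⟩ := a.2
    rw [mem_subRelFin_iff hR hpmp hm hS hSa, ae_finite_fiber_iff hgm hg hgc S.measurableSet]
    simp only [mem_iInter, mem_iUnion, Set.mem_ofPred_eq]
    refine forall_congr' fun k => exists_congr fun N => ?_
    constructor
    · intro h S' hS'
      refine (key _ _ _).1 ?_
      refine (measure_mono_ae ?_).trans h
      have hd := (mk_eq_mk_iff_measure_symmDiff.1 (hS'.trans hSa.symm))
      rw [hm.measure_eq_zero_iff hR (S'.measurableSet.symmDiff S.measurableSet)] at hd
      filter_upwards [hd] with x hx hxT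
      obtain ⟨n, hn, hxn⟩ := mem_iUnion₂.1 hxT
      refine mem_iUnion₂.2 ⟨n, hn, hxn.1, ?_⟩
      by_contra hnS
      have : g n x ∈ fiber ((S' : Set R) ∆ S) x := mem_fiber.2 ⟨hg n x, Or.inl ⟨hxn.2, hnS⟩⟩
      rw [hx] at this
      exact this
    · intro h
      exact (key _ _ _).2 (h S hSa)

end UpperBound

/-! ### Dividing an aperiodic relation in halves -/

section Halving

open Filter Topology

variable {X : Type u} [MeasurableSpace X] [StandardBorelSpace X] {R : Set (X × X)} {μ : Measure X}
  [IsFiniteMeasure μ]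

/-- Partial transversals of an aperiodic measure-preserving relation are null. -/
theorem IsAperiodic.measure_transversal_eq_zero (haper : IsAperiodic R μ) (hR : IsCBER R)
    (hpmp : PreservesMeasure R μ) {T : Set X} (hT : MeasurableSet T)
    (hTR : ∀ᵐ x ∂μ, x ∈ T → ∀ y ∈ T, (x, y) ∈ R → x = y) : μ T = 0 := by
  obtain ⟨g, hgm, hg, hgc⟩ := hR.exists_enumeration μ
  obtain ⟨N, hN, hNm, hN0, -⟩ := hpmp.exists_invariant_null hR
    (ae_iff.1 ((hgc.and haper).and hTR))
  have hgood : ∀ x ∉ N, ((∀ y, (x, y) ∈ R → ∃ n, g n x = y) ∧ {y | (x, y) ∈ R}.Infinite) ∧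
      (x ∈ T → ∀ y ∈ T, (x, y) ∈ R → x = y) := by
    intro x hx
    by_contra h
    exact hx (hN h)
  let P : ℕ → Set X := fun n => (T \ N) ∩ newFiberPoints g hg univ n
  have hPm : ∀ n, MeasurableSet (P n) := fun n =>
    (hT.diff hNm).inter (measurableSet_newFiberPoints hgm hg MeasurableSet.univ n)
  have heq : ∀ {x x' n k}, x ∈ P n → x' ∈ P k → g n x = g k x' → x = x' := by
    intro x x' n k hx hx' h
    refine (hgood x hx.1.2).2 hx.1.1 x' hx'.1.1 (hR.trans (hg n x) ?_)
    rw [h]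
    exact hR.symm (hg k x')
  have hinj : ∀ n, InjOn (g n) (P n) := fun n x hx x' hx' h => heq hx hx' h
  have hdisj : Pairwise (Function.onFun Disjoint fun n => g n '' P n) := by
    have hlt : ∀ {n k}, n < k → Disjoint (g n '' P n) (g k '' P k) := by
      intro n k hnk
      rw [Set.disjoint_left]
      rintro _ ⟨x, hx, rfl⟩ ⟨x', hx', h⟩
      obtain rfl := heq hx' hx h
      exact hx'.2.1 n hnk h.symm
    intro n k hnk
    rcases lt_or_gt_of_ne hnk with h | h
    exacts [hlt h, (hlt h).symm]
  have hsum : ∑' n, μ (P n) ≠ ∞ := by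
    have : ∑' n, μ (P n) = μ (⋃ n, g n '' P n) := by
      rw [measure_iUnion hdisj fun n => (hPm n).image_of_measurable_injOn (hgm n) (hinj n)]
      exact tsum_congr fun n => (hpmp _ _ (hPm n) (hgm n) (hinj n) fun x _ => hg n x).symm
    rw [this]
    exact measure_ne_top _ _
  -- Borel–Cantelli: the translates of a transversal are disjoint, so almost every point lies in
  -- finitely many `P n`, while an infinite class puts each good point of `T` in infinitely many.
  have hfreq := measure_setOfPred_frequently_eq_zero (p := fun n x => x ∈ P n) hsum
  refine measure_mono_null (t := N ∪ {x | ∃ᶠ n in atTop, x ∈ P n}) ?_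
    (measure_union_null hN0 hfreq)
  intro x hx
  by_cases hxN : x ∈ N
  · exact Or.inl hxN
  right
  obtain ⟨⟨h1, h2⟩, -⟩ := hgood x hxN
  have h3 : (fiber (univ : Set R) x).Infinite := by
    convert h2 using 1
    ext y
    simp [mem_fiber]
  refine frequently_atTop.2 fun M => ?_
  obtain ⟨n, hn, hxn⟩ := (infinite_fiber_iff (hg := hg) h1).1 h3 M
  exact ⟨n, hn, ⟨hx, hxN⟩, hxn⟩

/-- The points of `A ∩ U` which are exchanged by the pair `h`, `h'` with a point of `A \ U`. -/
def exchangeDomain (h h' : X → X) (U A : Set X) : Set X :=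
  {x | x ∈ A ∧ x ∈ U ∧ h x ∈ A ∧ h x ∉ U ∧ h' (h x) = x}

omit [StandardBorelSpace X] in
theorem measurableSet_exchangeDomain [MeasurableEq X] {h h' : X → X} (hh : Measurable h)
    (hh' : Measurable h') {U A : Set X} (hU : MeasurableSet U) (hA : MeasurableSet A) :
    MeasurableSet (exchangeDomain h h' U A) :=
  hA.inter (hU.inter ((hh hA).inter ((hh hU.compl).inter
    (measurableSet_eq_fun (hh'.comp hh) measurable_id))))

/-- What remains of `A` after removing successively the points exchanged by the pairs `h j`,
`h' j`. -/
def exchangeRemainder (h h' : ℕ → X → X) (U : ℕ → Set X) (A : Set X) : ℕ → Set X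
  | 0 => A
  | j + 1 => exchangeRemainder h h' U A j \
      (exchangeDomain (h j) (h' j) (U j) (exchangeRemainder h h' U A j) ∪
        exchangeDomain (h' j) (h j) (U j)ᶜ (exchangeRemainder h h' U A j))

/-- Greedily pair equivalent points of `A`, one on each side of a separating Borel set. What is
never paired is a partial transversal up to a null set, hence null by aperiodicity. `r` sends the
first point of each pair to the second and fixes everything else. -/
theorem exists_halving (hR : IsCBER R) (hpmp : PreservesMeasure R μ) (haper : IsAperiodic R μ)
    (A : Set X) (hA : MeasurableSet A) :
    ∃ (B : Set X) (r : X → X), MeasurableSet B ∧ B ⊆ A ∧ Measurable r ∧ (∀ x, (x, r x) ∈ R) ∧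
      (∀ x ∈ A, r x ∈ B) ∧ (∀ x ∈ B, r x = x) ∧ InjOn r (A \ B) ∧
      ∀ᵐ x ∂μ, x ∈ B → ∃ y ∈ A \ B, r y = x := by
  classical
  obtain ⟨g, hgm, hg, hgc⟩ := hR.exists_enumeration μ
  obtain ⟨V, hVm, hV⟩ := exists_seq_separating X MeasurableSet.empty (univ : Set X)
  -- `j` codes a triple: a map, a candidate inverse, and a separating set.
  let h : ℕ → X → X := fun j => g j.unpair.1
  let h' : ℕ → X → X := fun j => g j.unpair.2.unpair.1
  let U : ℕ → Set X := fun j => V j.unpair.2.unpair.2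
  let Q : ℕ → Set X := exchangeRemainder h h' U A
  let D : ℕ → Set X := fun j => exchangeDomain (h j) (h' j) (U j) (Q j)
  let D' : ℕ → Set X := fun j => exchangeDomain (h' j) (h j) (U j)ᶜ (Q j)
  have hQs : ∀ j, Q (j + 1) = Q j \ (D j ∪ D' j) := fun j => rfl
  have hQm : ∀ j, MeasurableSet (Q j) := by
    intro j
    induction j with
    | zero => exact hA
    | succ j ih =>
      rw [hQs]
      exact ih.diff ((measurableSet_exchangeDomain (hgm _) (hgm _) (hVm _) ih).union
        (measurableSet_exchangeDomain (hgm _) (hgm _) (hVm _).compl ih))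
  have hDm : ∀ j, MeasurableSet (D j) := fun j =>
    measurableSet_exchangeDomain (hgm _) (hgm _) (hVm _) (hQm j)
  have hQanti : Antitone Q := antitone_nat_of_succ_le fun j => by
    rw [hQs]; exact sdiff_subset
  have hDQ : ∀ {j x}, x ∈ D j → x ∈ Q j ∧ x ∉ Q (j + 1) := fun {j x} hx =>
    ⟨hx.1, fun hx' => ((hQs j) ▸ hx').2 (Or.inl hx)⟩
  have hDQ' : ∀ {j x}, x ∈ D' j → x ∈ Q j ∧ x ∉ Q (j + 1) := fun {j x} hx =>
    ⟨hx.1, fun hx' => ((hQs j) ▸ hx').2 (Or.inr hx)⟩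
  have hstage : ∀ {i j x}, (x ∈ Q i ∧ x ∉ Q (i + 1)) → (x ∈ Q j ∧ x ∉ Q (j + 1)) → i = j := by
    have : ∀ {i j x}, (x ∈ Q i ∧ x ∉ Q (i + 1)) → (x ∈ Q j ∧ x ∉ Q (j + 1)) → i ≤ j := by
      intro i j x hi hj
      by_contra hlt
      exact hj.2 (hQanti (Nat.succ_le_of_lt (not_le.1 hlt)) hi.1)
    exact fun {i j x} hi hj => le_antisymm (this hi hj) (this hj hi)
  have hDD' : ∀ {j x}, x ∈ D j → h j x ∈ D' j := by
    rintro j x ⟨h1, h2, h3, h4, h5⟩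
    refine ⟨h3, h4, ?_, ?_, ?_⟩
    · rwa [h5]
    · rw [h5]; exact not_not.2 h2
    · rw [h5]
  have hD'D : ∀ {j x}, x ∈ D' j → h' j x ∈ D j := by
    rintro j x ⟨h1, h2, h3, h4, h5⟩
    refine ⟨h3, not_not.1 h4, ?_, ?_, ?_⟩
    · rwa [h5]
    · rw [h5]; exact h2
    · rw [h5]
  have hD'not : ∀ {i j x}, x ∈ D' j → x ∉ D i := by
    intro i j x hx hxi
    obtain rfl := hstage (hDQ hxi) (hDQ' hx)
    exact hx.2.1 hxi.2.1
  let r : X → X := fun x => if hx : ∃ j, x ∈ D j then h hx.choose x else x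
  have hrD : ∀ {j x}, x ∈ D j → r x = h j x := by
    intro j x hx
    have hex : ∃ j, x ∈ D j := ⟨j, hx⟩
    have : hex.choose = j := hstage (hDQ hex.choose_spec) (hDQ hx)
    simp only [r, dif_pos hex, this]
  have hrn : ∀ {x}, (∀ j, x ∉ D j) → r x = x := by
    intro x hx
    exact dif_neg (not_exists.2 hx)
  have hQA : ∀ j, Q j ⊆ A := fun j => hQanti (Nat.zero_le j)
  have hmem : ∀ {x}, x ∈ A \ (A \ ⋃ j, D j) → ∃ j, x ∈ D j := by
    rintro x ⟨hx, hx'⟩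
    by_contra hne
    exact hx' ⟨hx, fun hU => hne (mem_iUnion.1 hU)⟩
  refine ⟨A \ ⋃ j, D j, r, hA.diff (MeasurableSet.iUnion hDm), sdiff_subset, ?_, ?_, ?_, ?_, ?_, ?_⟩
  · intro S hS
    have : r ⁻¹' S = (⋃ j, D j ∩ h j ⁻¹' S) ∪ ((⋃ j, D j)ᶜ ∩ S) := by
      ext x
      by_cases hx : ∃ j, x ∈ D j
      · obtain ⟨j, hj⟩ := hx
        rw [mem_preimage, hrD hj]
        constructor
        · exact fun hS => Or.inl (mem_iUnion.2 ⟨j, hj, hS⟩)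
        · rintro (hx | hx)
          · obtain ⟨i, hi, hiS⟩ := mem_iUnion.1 hx
            obtain rfl := hstage (hDQ hi) (hDQ hj)
            exact hiS
          · exact (hx.1 (mem_iUnion.2 ⟨j, hj⟩)).elim
      · rw [mem_preimage, hrn (not_exists.1 hx)]
        constructor
        · exact fun hS => Or.inr ⟨fun hU => hx (mem_iUnion.1 hU), hS⟩
        · rintro (h | h)
          · obtain ⟨i, hi, -⟩ := mem_iUnion.1 h
            exact (hx ⟨i, hi⟩).elim
          · exact h.2
    rw [this]
    exact (MeasurableSet.iUnion fun j => (hDm j).inter (hgm _ hS)).union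
      ((MeasurableSet.iUnion hDm).compl.inter hS)
  · intro x
    by_cases hx : ∃ j, x ∈ D j
    · obtain ⟨j, hj⟩ := hx
      rw [hrD hj]
      exact hg _ x
    · rw [hrn (not_exists.1 hx)]
      exact hR.refl x
  · intro x hxA
    by_cases hx : ∃ j, x ∈ D j
    · obtain ⟨j, hj⟩ := hx
      rw [hrD hj]
      refine ⟨hQA j (hDD' hj).1, fun hU => ?_⟩
      obtain ⟨i, hi⟩ := mem_iUnion.1 hU
      exact hD'not (hDD' hj) hi
    · rw [hrn (not_exists.1 hx)]
      exact ⟨hxA, fun hU => hx (mem_iUnion.1 hU)⟩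
  · exact fun x hx => hrn fun j hj => hx.2 (mem_iUnion.2 ⟨j, hj⟩)
  · intro x hx x' hx' hxx
    obtain ⟨j, hj⟩ := hmem hx
    obtain ⟨i, hi⟩ := hmem hx'
    rw [hrD hj, hrD hi] at hxx
    have hji : j = i := hstage (hDQ' (hDD' hj)) (hxx ▸ hDQ' (hDD' hi))
    subst hji
    rw [← hj.2.2.2.2, ← hi.2.2.2.2, hxx]
  · have hnull : μ (⋂ j, Q j) = 0 := by
      refine haper.measure_transversal_eq_zero hR hpmp (MeasurableSet.iInter hQm) ?_
      filter_upwards [hpmp.ae_forall_class hR hgc] with x hx hxT y hyT hxy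
      have key : ∀ x y, (∀ z, (x, z) ∈ R → ∃ n, g n x = z) → (∀ z, (y, z) ∈ R → ∃ n, g n y = z) →
          (x, y) ∈ R → x ∈ (⋂ j, Q j) → y ∈ (⋂ j, Q j) → ∀ k, x ∈ V k → y ∈ V k := by
        intro x y hx hy hxy hxT hyT k hxk
        by_contra hyk
        obtain ⟨n, hn⟩ := hx y hxy
        obtain ⟨p, hp⟩ := hy x (hR.symm hxy)
        have hxT' := mem_iInter.1 hxT
        have hyT' := mem_iInter.1 hyT
        have hxD : x ∈ D (Nat.pair n (Nat.pair p k)) := by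
          refine ⟨hxT' _, ?_, ?_, ?_, ?_⟩
          · simpa [U] using hxk
          · simpa [h, hn] using hyT' _
          · simpa [h, U, hn] using hyk
          · simp [h, h', hn, hp]
        exact (hDQ hxD).2 (hxT' _)
      exact hV x (mem_univ _) y (mem_univ _) fun k =>
        ⟨key x y (hx x (hR.refl x)) (hx y hxy) hxy hxT hyT k,
          key y x (hx y hxy) (hx x (hR.refl x)) (hR.symm hxy) hyT hxT k⟩
    filter_upwards [measure_eq_zero_iff_ae_notMem.1 hnull] with x hx hxB
    have hex : ∃ j, x ∉ Q j := by simpa using hx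
    obtain ⟨j, hj, hj'⟩ : ∃ j, x ∈ Q j ∧ x ∉ Q (j + 1) := by
      have h1 := Nat.find_spec hex
      have h2 : Nat.find hex ≠ 0 := by
        intro h0
        rw [h0] at h1
        exact h1 hxB.1
      obtain ⟨j, hj⟩ := Nat.exists_eq_succ_of_ne_zero h2
      exact ⟨j, not_not.1 (Nat.find_min hex (by omega)), by rw [hj] at h1; exact h1⟩
    have hxD : x ∈ D' j := by
      rw [hQs] at hj'
      by_contra hne
      refine hj' ⟨hj, ?_⟩
      rintro (h | h)
      · exact hxB.2 (mem_iUnion.2 ⟨j, h⟩)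
      · exact hne h
    refine ⟨h' j x, ⟨hQA j (hD'D hxD).1, fun hB => hB.2 (mem_iUnion.2 ⟨j, hD'D hxD⟩)⟩, ?_⟩
    rw [hrD (hD'D hxD)]
    exact hxD.2.2.2.2

/-- A sequence of Borel retractions of `R` and of binary digits: `π n x` and the first `n` digits
determine `x`, and almost surely all sequences of digits occur. -/
structure DyadicTower (R : Set (X × X)) (μ : Measure X) where
  /-- The retractions. -/
  π : ℕ → X → X
  /-- The digits. -/
  b : ℕ → X → Prop
  measurable_π : ∀ n, Measurable (π n)
  measurable_b : ∀ n, Measurable (b n)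
  π_zero : ∀ x, π 0 x = x
  mem_rel : ∀ n x, (x, π n x) ∈ R
  π_succ_congr : ∀ n x y, π n x = π n y → π (n + 1) x = π (n + 1) y ∧ (b n x ↔ b n y)
  π_eq_of_succ : ∀ n x y, π (n + 1) x = π (n + 1) y → (b n x ↔ b n y) → π n x = π n y
  ae_exists_digits : ∀ᵐ x ∂μ, ∀ (n : ℕ) (s : ℕ → Prop),
    ∃ y, π n y = π n x ∧ ∀ j < n, (b j y ↔ s j)

theorem exists_dyadicTower (hR : IsCBER R) (hpmp : PreservesMeasure R μ)
    (haper : IsAperiodic R μ) : Nonempty (DyadicTower R μ) := by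
  have : Nonempty (X → X) := ⟨id⟩
  choose! B r hBm hBA hrm hrR hrB hrid hrinj hrsurj using exists_halving hR hpmp haper
  let Q : ℕ → Set X := fun n => Nat.rec univ (fun _ A => B A) n
  have hQm : ∀ n, MeasurableSet (Q n) := by
    intro n
    induction n with
    | zero => exact MeasurableSet.univ
    | succ n ih => exact hBm _ ih
  let π : ℕ → X → X := fun n => Nat.rec id (fun n f x => r (Q n) (f x)) n
  have hπs : ∀ n x, π (n + 1) x = r (Q n) (π n x) := fun n x => rfl
  have hπm : ∀ n, Measurable (π n) := by
    intro n
    induction n with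
    | zero => exact measurable_id
    | succ n ih => exact (hrm _ (hQm n)).comp ih
  have hπQ : ∀ n x, π n x ∈ Q n := by
    intro n x
    induction n with
    | zero => exact mem_univ _
    | succ n ih => exact hrB _ (hQm n) _ ih
  have hπR : ∀ n x, (x, π n x) ∈ R := by
    intro n x
    induction n with
    | zero => exact hR.refl x
    | succ n ih => exact hR.trans ih (hrR _ (hQm n) _)
  -- Digit `n` records in which half of `Q n` the point `π n x` lies; with `π (n + 1) x` it
  -- determines `π n x`, since `r (Q n)` is injective on each half.
  refine ⟨⟨π, fun n x => π n x ∈ Q (n + 1), hπm, fun n => ?_, fun x => rfl, hπR, ?_, ?_, ?_⟩⟩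
  · exact measurableSet_setOfPred.1 (hπm n (hQm (n + 1)))
  · intro n x y h
    rw [hπs, hπs, h]
    exact ⟨rfl, Iff.rfl⟩
  · intro n x y h hb
    rw [hπs, hπs] at h
    by_cases hx : π n x ∈ Q (n + 1)
    · rwa [hrid _ (hQm n) _ hx, hrid _ (hQm n) _ (hb.1 hx)] at h
    · exact hrinj _ (hQm n) ⟨hπQ n x, hx⟩ ⟨hπQ n y, fun hy => hx (hb.2 hy)⟩ h
  -- Prescribing digits means pulling back repeatedly along `r (Q n)`, through other points of the
  -- class, so surjectivity is needed on whole classes.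
  · have hall := hpmp.ae_forall_class hR (ae_all_iff.2 fun n => hrsurj (Q n) (hQm n))
    filter_upwards [hall] with x hx n s
    have key : ∀ n z, z ∈ Q n → (x, z) ∈ R →
        ∃ y, π n y = z ∧ ∀ j < n, (π j y ∈ Q (j + 1) ↔ s j) := by
      intro n
      induction n with
      | zero => exact fun z _ _ => ⟨z, rfl, fun j hj => (Nat.not_lt_zero j hj).elim⟩
      | succ n ih =>
        intro z hz hxz
        obtain ⟨w, hwQ, hwz, hws⟩ : ∃ w ∈ Q n, r (Q n) w = z ∧ (w ∈ Q (n + 1) ↔ s n) := by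
          by_cases hs : s n
          · exact ⟨z, hBA _ (hQm n) hz, hrid _ (hQm n) _ hz, iff_of_true hz hs⟩
          · obtain ⟨w, hw, hwz⟩ := hx z hxz n hz
            exact ⟨w, hw.1, hwz, iff_of_false hw.2 hs⟩
        have hxw : (x, w) ∈ R := hR.trans hxz (hR.symm (hwz ▸ hrR _ (hQm n) w))
        obtain ⟨y, hy, hys⟩ := ih w hwQ hxw
        refine ⟨y, by rw [hπs, hy, hwz], fun j hj => ?_⟩
        rcases Nat.lt_succ_iff_lt_or_eq.1 hj with hj | rfl
        · exact hys j hj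
        · rw [hy]; exact hws
    exact key n (π n x) (hπQ n x) (hπR n x)

end Halving

/-! ### Subequivalence relations coded by arrays of digits -/

section Coding

variable {X : Type u} [MeasurableSpace X] {R : Set (X × X)} {μ : Measure X}

namespace DyadicTower

variable (t : DyadicTower R μ)

/-- `x` and `y` have a common retraction. -/
def Tail (x y : X) : Prop := ∃ k, t.π k x = t.π k y

/-- The first vanishing digit of `x` has index `n`. -/
def Stage (n : ℕ) (x : X) : Prop := (∀ j < n, t.b j x) ∧ ¬ t.b n x

/-- The subequivalence relation coded by `c`: on the points of stage `n`, one may change finitely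
many of the digits with index `i > n` for which `c n i` holds. -/
def Rel (c : ℕ → ℕ → Prop) (x y : X) : Prop :=
  t.Tail x y ∧ (∀ n, t.Stage n x ↔ t.Stage n y) ∧
    ∀ i, (∃ n < i, t.Stage n x ∧ c n i) ∨ (t.b i x ↔ t.b i y)

variable {t}

theorem π_congr_of_le {x y : X} {k n : ℕ} (hkn : k ≤ n) (h : t.π k x = t.π k y) :
    t.π n x = t.π n y := by
  induction n, hkn using Nat.le_induction with
  | base => exact h
  | succ n _ ih => exact (t.π_succ_congr n x y ih).1

theorem b_congr_of_le {x y : X} {k n : ℕ} (hkn : k ≤ n) (h : t.π k x = t.π k y) :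
    t.b n x ↔ t.b n y := (t.π_succ_congr n x y (π_congr_of_le hkn h)).2

theorem Tail.eq {x y : X} (h : t.Tail x y) (hb : ∀ i, t.b i x ↔ t.b i y) : x = y := by
  obtain ⟨k, hk⟩ := h
  induction k with
  | zero => rwa [t.π_zero, t.π_zero] at hk
  | succ k ih => exact ih (t.π_eq_of_succ k x y hk (hb k))

theorem Tail.trans {x y z : X} (h : t.Tail x y) (h' : t.Tail y z) : t.Tail x z := by
  obtain ⟨k, hk⟩ := h
  obtain ⟨l, hl⟩ := h'
  exact ⟨max k l, (π_congr_of_le (le_max_left k l) hk).trans (π_congr_of_le (le_max_right k l) hl)⟩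

theorem Tail.mem_rel (hR : IsCBER R) {x y : X} (h : t.Tail x y) : (x, y) ∈ R := by
  obtain ⟨k, hk⟩ := h
  exact hR.trans (t.mem_rel k x) (hk ▸ hR.symm (t.mem_rel k y))

theorem Stage.unique {x : X} {n k : ℕ} (h : t.Stage n x) (h' : t.Stage k x) : n = k := by
  rcases lt_trichotomy n k with hnk | hnk | hnk
  · exact (h.2 (h'.1 n hnk)).elim
  · exact hnk
  · exact (h'.2 (h.1 k hnk)).elim

theorem stage_congr {x y : X} {n : ℕ} (h : ∀ j ≤ n, t.b j x ↔ t.b j y) :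
    t.Stage n x ↔ t.Stage n y := by
  unfold Stage
  rw [h n le_rfl]
  exact and_congr_left fun _ => forall₂_congr fun j hj => h j hj.le

theorem equivalence_rel (c : ℕ → ℕ → Prop) : Equivalence (t.Rel c) where
  refl x := ⟨⟨0, rfl⟩, fun _ => Iff.rfl, fun _ => Or.inr Iff.rfl⟩
  symm := by
    rintro x y ⟨⟨k, hk⟩, h2, h3⟩
    refine ⟨⟨k, hk.symm⟩, fun n => (h2 n).symm, fun i => ?_⟩
    exact (h3 i).imp (fun ⟨n, hn, hs, hc⟩ => ⟨n, hn, (h2 n).1 hs, hc⟩) Iff.symm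
  trans := by
    rintro x y z ⟨h1, h2, h3⟩ ⟨h1', h2', h3'⟩
    refine ⟨h1.trans h1', fun n => (h2 n).trans (h2' n), fun i => ?_⟩
    rcases h3 i with h | h
    · exact Or.inl h
    rcases h3' i with ⟨n, hn, hs, hc⟩ | h'
    · exact Or.inl ⟨n, hn, (h2 n).2 hs, hc⟩
    · exact Or.inr (h.trans h')

/-- Points of one class are told apart by their digits in the row of `c` given by the stage of `x`.
A point without a stage is alone in its class. -/
theorem finite_rel {c : ℕ → ℕ → Prop} (hc : ∀ n, {i | c n i}.Finite) (x : X) :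
    {y | t.Rel c x y}.Finite := by
  have hI : {i | ∃ n, t.Stage n x ∧ c n i}.Finite := by
    by_cases h : ∃ n, t.Stage n x
    · obtain ⟨n, hn⟩ := h
      refine (hc n).subset ?_
      rintro i ⟨k, hk, hki⟩
      rwa [← hn.unique hk] at hki
    · convert finite_empty (α := ℕ)
      exact eq_empty_of_forall_notMem fun i ⟨n, hn, _⟩ => h ⟨n, hn⟩
  refine Finite.of_finite_image (f := fun y => {i | (∃ n, t.Stage n x ∧ c n i) ∧ t.b i y})
    (hI.finite_subsets.subset ?_) ?_
  · rintro _ ⟨y, -, rfl⟩ i hi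
    exact hi.1
  · intro y hy z hz hyz
    have hyz' := (equivalence_rel c).trans ((equivalence_rel c).symm hy) hz
    refine hyz'.1.eq fun i => ?_
    by_cases hi : ∃ n, t.Stage n x ∧ c n i
    · have : i ∈ {i | (∃ n, t.Stage n x ∧ c n i) ∧ t.b i y} ↔
          i ∈ {i | (∃ n, t.Stage n x ∧ c n i) ∧ t.b i z} := by
        rw [show {i | (∃ n, t.Stage n x ∧ c n i) ∧ t.b i y} = _ from hyz]
      exact ⟨fun h => (this.1 ⟨hi, h⟩).2, fun h => (this.2 ⟨hi, h⟩).2⟩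
    · refine (hyz'.2.2 i).resolve_left ?_
      rintro ⟨n, -, hn, hni⟩
      exact hi ⟨n, (hy.2.1 n).2 hn, hni⟩

/-- Changing the single digit `i` of `x`, for each `i > n` in row `n`, gives distinct related
points. The restriction `i > n` preserves the stage. -/
theorem infinite_rel {c : ℕ → ℕ → Prop} {n : ℕ} (hc : {i | c n i}.Infinite) {x : X}
    (hx : ∀ (n : ℕ) (s : ℕ → Prop), ∃ y, t.π n y = t.π n x ∧ ∀ j < n, (t.b j y ↔ s j))
    (hn : t.Stage n x) : {y | t.Rel c x y}.Infinite := by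
  have hy : ∀ i, ∃ y, t.π (i + 1) y = t.π (i + 1) x ∧ (∀ j ≠ i, t.b j y ↔ t.b j x) ∧
      (t.b i y ↔ ¬ t.b i x) := by
    intro i
    obtain ⟨y, hy, hyb⟩ := hx (i + 1) fun j => if j = i then ¬ t.b i x else t.b j x
    refine ⟨y, hy, fun j hj => ?_, by simpa using hyb i i.lt_succ_self⟩
    rcases lt_or_ge j (i + 1) with h | h
    · simpa [hj] using hyb j h
    · exact b_congr_of_le h hy
  choose y hy hyne hyeq using hy
  have hinf : {i | c n i ∧ n < i}.Infinite := by
    have : {i | c n i ∧ n < i} = {i | c n i} \ Iic n := by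
      ext i; simp
    rw [this]
    exact hc.sdiff (finite_Iic n)
  refine infinite_of_injOn_mapsTo (f := y) ?_ ?_ hinf
  · intro i _ j _ hij
    by_contra hne
    have h1 := hyne j i hne
    rw [← hij, hyeq i] at h1
    tauto
  · rintro i ⟨hci, hni⟩
    have hyn : t.Stage n (y i) :=
      (stage_congr fun j hj => (hyne i j (hj.trans_lt hni).ne)).2 hn
    refine ⟨⟨i + 1, (hy i).symm⟩, fun k => ?_, fun j => ?_⟩
    · exact ⟨fun h => hn.unique h ▸ hyn, fun h => hyn.unique h ▸ hn⟩
    · by_cases hj : j = i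
      · subst hj
        exact Or.inl ⟨n, hni, hn, hci⟩
      · exact Or.inr (hyne i j hj).symm

theorem measurable_tail [MeasurableEq X] : MeasurableSet {q : X × X | t.Tail q.1 q.2} := by
  have : {q : X × X | t.Tail q.1 q.2} = ⋃ k, {q | t.π k q.1 = t.π k q.2} := by
    ext q
    simp [Tail]
  rw [this]
  exact MeasurableSet.iUnion fun k => measurableSet_eq_fun ((t.measurable_π k).comp measurable_fst)
    ((t.measurable_π k).comp measurable_snd)

theorem measurable_stage (n : ℕ) : Measurable (t.Stage n) :=
  (Measurable.forall fun j => Measurable.imp measurable_const (t.measurable_b j)).and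
    (t.measurable_b n).not

theorem measurableSet_rel [MeasurableEq X] (c : ℕ → ℕ → Prop) :
    MeasurableSet {q : X × X | t.Rel c q.1 q.2} := by
  refine (measurable_tail (t := t)).inter (measurableSet_setOfPred.2 ?_)
  refine (Measurable.forall fun n => ((measurable_stage n).comp measurable_fst).iff
    ((measurable_stage n).comp measurable_snd)).and (Measurable.forall fun i => ?_)
  refine (Measurable.exists fun n => ?_).or (((t.measurable_b i).comp measurable_fst).iff
    ((t.measurable_b i).comp measurable_snd))
  exact measurable_const.and (((measurable_stage n).comp measurable_fst).and measurable_const)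

variable (t)

/-- The element of the measure algebra given by the relation coded by `c`. -/
def relSet [MeasurableEq X] (m : Measure R) (c : ℕ → ℕ → Prop) : MeasuredSets m :=
  ⟨{q | t.Rel c q.1.1 q.1.2}, measurable_subtype_coe (measurableSet_rel c)⟩

variable {t}

theorem fiber_relSet [MeasurableEq X] (hR : IsCBER R) (m : Measure R) (c : ℕ → ℕ → Prop) (x : X) :
    fiber (t.relSet m c : Set R) x = {y | t.Rel c x y} := by
  ext y
  rw [mem_fiber]
  constructor
  · exact fun h => h.2
  · exact fun h => ⟨h.1.mem_rel hR, h⟩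

theorem isSubequivalence_relSet [MeasurableEq X] (hR : IsCBER R) (m : Measure R)
    (c : ℕ → ℕ → Prop) : IsSubequivalence (t.relSet m c : Set R) := by
  have : (fun x y => y ∈ fiber (t.relSet m c : Set R) x) = t.Rel c := by
    funext x y
    rw [fiber_relSet hR]
    rfl
  unfold IsSubequivalence
  rw [this]
  exact equivalence_rel c

theorem ae_finite_relSet_iff [StandardBorelSpace X] [IsProbabilityMeasure μ] (hR : IsCBER R)
    (hpmp : PreservesMeasure R μ) (m : Measure R) (c : ℕ → ℕ → Prop) :
    (∀ᵐ x ∂μ, (fiber (t.relSet m c : Set R) x).Finite) ↔ ∀ n, {i | c n i}.Finite := by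
  simp only [fiber_relSet hR]
  constructor
  · intro h n
    by_contra hinf
    have h1 : ∀ᵐ x ∂μ, ¬ t.Stage n x := by
      filter_upwards [h, t.ae_exists_digits] with x hx hxd hn
      exact infinite_rel hinf hxd hn hx
    -- No stage is null: almost every class contains a point with `n` true digits followed by a
    -- false one.
    obtain ⟨x, hx, hxd⟩ := ((hpmp.ae_forall_class hR h1).and t.ae_exists_digits).exists
    obtain ⟨y, hy, hyb⟩ := hxd (n + 1) fun j => j < n
    refine hx y (Tail.mem_rel hR ⟨n + 1, hy.symm⟩) ⟨fun j hj => (hyb j (by omega)).2 hj, ?_⟩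
    exact fun hbn => lt_irrefl n ((hyb n n.lt_succ_self).1 hbn)
  · exact fun h => Filter.Eventually.of_forall fun x => finite_rel h x

end DyadicTower

end Coding

/-! ### Hardness -/

section Hardness

open Filter Topology
open scoped symmDiff

variable {Y : Type v} [TopologicalSpace Y]

theorem exists_disjoint_isClopen_iUnion_eq [SecondCountableTopology Y]
    (hY : TopologicalSpace.IsTopologicalBasis {U : Set Y | IsClopen U}) {V : Set Y}
    (hV : IsOpen V) : ∃ W : ℕ → Set Y, (∀ j, IsClopen (W j)) ∧ Pairwise (Function.onFun Disjoint W) ∧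
      V = ⋃ j, W j := by
  obtain ⟨W, hW, hVW⟩ : ∃ W : ℕ → Set Y, (∀ j, IsClopen (W j)) ∧ V = ⋃ j, W j := by
    obtain ⟨S, hS, hVS⟩ := hY.open_eq_sUnion hV
    obtain ⟨T, hTc, hTS, hTU⟩ :=
      TopologicalSpace.isOpen_sUnion_countable S fun s hs => (hS hs).isOpen
    obtain ⟨W, hW⟩ := (hTc.insert ∅).exists_eq_range (insert_nonempty _ _)
    refine ⟨W, fun j => ?_, ?_⟩
    · have : W j ∈ insert ∅ T := hW ▸ mem_range_self j
      rcases this with h | h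
      · rw [h]; exact isClopen_empty
      · exact hS (hTS h)
    · rw [hVS, ← hTU, ← sUnion_range, ← hW, sUnion_insert, empty_union]
  refine ⟨disjointed W, fun j => ?_, disjoint_disjointed W, ?_⟩
  · exact disjointedRec (fun _ _ h => h.diff (hW _)) (hW j)
  · rw [iUnion_disjointed, hVW]

/-- Make the closed sets increasing and split the complement of the `k`-th into disjoint clopen
pieces. Then `y` lies in exactly one piece for each `k` whose closed set omits it, and in none for
the other `k`. -/
theorem exists_isClopen_finite_iff [SecondCountableTopology Y]
    (hY : TopologicalSpace.IsTopologicalBasis {U : Set Y | IsClopen U}) {C : ℕ → Set Y}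
    (hC : ∀ k, IsClosed (C k)) :
    ∃ U : ℕ → Set Y, (∀ i, IsClopen (U i)) ∧ ∀ y, y ∈ ⋃ k, C k ↔ {i | y ∈ U i}.Finite := by
  have hop : ∀ k, IsOpen (accumulate C k)ᶜ := by
    intro k
    rw [isOpen_compl_iff, accumulate_def]
    exact (finite_Iic k).isClosed_biUnion fun i _ => hC i
  choose W hW hWd hWU using fun k => exists_disjoint_isClopen_iUnion_eq hY (hop k)
  refine ⟨fun i => W i.unpair.1 i.unpair.2, fun i => hW _ _, fun y => ?_⟩
  have hmem : ∀ k, y ∉ accumulate C k ↔ ∃ j, y ∈ W k j := by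
    intro k
    rw [← mem_compl_iff, hWU k, mem_iUnion]
  constructor
  · intro hy
    rw [← iUnion_accumulate, mem_iUnion] at hy
    obtain ⟨k, hk⟩ := hy
    have hlt : ∀ i : ℕ, y ∈ W i.unpair.1 i.unpair.2 → i.unpair.1 < k := by
      intro i hi
      by_contra hge
      exact (hmem _).2 ⟨_, hi⟩ (monotone_accumulate (not_lt.1 hge) hk)
    refine Finite.of_finite_image (f := fun i : ℕ => i.unpair.1) ((finite_Iio k).subset ?_) ?_
    · rintro _ ⟨i, hi, rfl⟩
      exact hlt i hi
    · intro i hi j hj hij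
      have h1 : i.unpair.1 = j.unpair.1 := hij
      have h2 : i.unpair.2 = j.unpair.2 := by
        by_contra hne
        refine Set.disjoint_left.1 (hWd i.unpair.1 hne) hi ?_
        rw [h1]; exact hj
      rw [← Nat.pair_unpair i, ← Nat.pair_unpair j, h1, h2]
  · intro hfin
    by_contra hy
    rw [← iUnion_accumulate, mem_iUnion, not_exists] at hy
    choose j hj using fun k => (hmem k).1 (hy k)
    refine infinite_of_injective_forall_mem (f := fun k => Nat.pair k (j k)) ?_ ?_ hfin
    · intro a b hab
      exact (Nat.pair_eq_pair.1 hab).1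
    · intro k
      simpa using hj k

variable {X : Type u} [MeasurableSpace X] {R : Set (X × X)} {μ : Measure X} {m : Measure R}

/-- Arrays that agree on indices below `K` code the same relation outside `W K`, the tail-equivalent
pairs that differ at some digit of index at least `K`. These sets decrease to the empty set, and
finitely many clopen entries are locally constant. -/
theorem continuous_relSet [MeasurableEq X] [IsFiniteMeasure m] (t : DyadicTower R μ)
    {U : ℕ → ℕ → Set Y} (hU : ∀ n i, IsClopen (U n i)) :
    Continuous fun y => t.relSet m fun n i => y ∈ U n i := by
  let W : ℕ → Set R := fun K =>
    {q | t.Tail q.1.1 q.1.2 ∧ ∃ i, K ≤ i ∧ ¬ (t.b i q.1.1 ↔ t.b i q.1.2)}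
  have hp1 : Measurable fun r : R => r.1.1 := measurable_fst.comp measurable_subtype_coe
  have hp2 : Measurable fun r : R => r.1.2 := measurable_snd.comp measurable_subtype_coe
  have hWm : ∀ K, MeasurableSet (W K) := by
    intro K
    refine (measurable_subtype_coe (DyadicTower.measurable_tail (t := t))).inter
      (measurableSet_setOfPred.2 (Measurable.exists fun i => measurable_const.and ?_))
    exact (((t.measurable_b i).comp hp1).iff ((t.measurable_b i).comp hp2)).not
  have hWa : Antitone W := fun K L hKL q hq =>
    ⟨hq.1, hq.2.imp fun i hi => ⟨hKL.trans hi.1, hi.2⟩⟩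
  have hWe : ⋂ K, W K = ∅ := by
    refine eq_empty_of_forall_notMem fun q hq => ?_
    rw [mem_iInter] at hq
    obtain ⟨k, hk⟩ := (hq 0).1
    obtain ⟨-, i, hi, hib⟩ := hq k
    exact hib (DyadicTower.b_congr_of_le hi hk)
  have hlim := tendsto_measure_iInter_atTop (μ := m) (fun K => (hWm K).nullMeasurableSet) hWa
    ⟨0, measure_ne_top _ _⟩
  rw [hWe, measure_empty] at hlim
  refine continuous_iff_continuousAt.2 fun y => ?_
  refine Metric.tendsto_nhds.2 fun ε hε => ?_
  obtain ⟨K, hK⟩ := ((tendsto_order.1 hlim).2 _ (ENNReal.ofReal_pos.2 hε)).exists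
  have hev : ∀ᶠ y' in 𝓝 y, ∀ n < K, ∀ i < K, (y' ∈ U n i ↔ y ∈ U n i) := by
    refine (eventually_all_finite (finite_Iio K)).2 fun n _ =>
      (eventually_all_finite (finite_Iio K)).2 fun i _ => ?_
    by_cases hy : y ∈ U n i
    · filter_upwards [(hU n i).isOpen.mem_nhds hy] with y' hy'
      exact iff_of_true hy' hy
    · filter_upwards [(hU n i).compl.isOpen.mem_nhds hy] with y' hy'
      exact iff_of_false hy' hy
  filter_upwards [hev] with y' hy'
  have hdiff : ∀ c c' : ℕ → ℕ → Prop, (∀ n < K, ∀ i < K, (c n i ↔ c' n i)) →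
      ∀ q : R, t.Rel c q.1.1 q.1.2 → ¬ t.Rel c' q.1.1 q.1.2 → q ∈ W K := by
    intro c c' hcc q hq hq'
    refine ⟨hq.1, ?_⟩
    by_contra hW
    refine hq' ⟨hq.1, hq.2.1, fun i => ?_⟩
    by_cases hib : t.b i q.1.1 ↔ t.b i q.1.2
    · exact Or.inr hib
    · obtain ⟨n, hn, hs, hc⟩ := (hq.2.2 i).resolve_right hib
      have hiK : i < K := by
        by_contra hge
        exact hW ⟨i, not_lt.1 hge, hib⟩
      exact Or.inl ⟨n, hn, hs, (hcc n (hn.trans hiK) i hiK).1 hc⟩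
  rw [MeasuredSets.dist_def]
  refine ENNReal.toReal_lt_of_lt_ofReal ((measure_mono ?_).trans_lt hK)
  rintro q (⟨h1, h2⟩ | ⟨h1, h2⟩)
  · exact hdiff _ _ hy' q h1 h2
  · exact hdiff _ _ (fun n hn i hi => (hy' n hn i hi).symm) q h1 h2

theorem isFSigmaDeltaHard_subRelFin [StandardBorelSpace X] [IsProbabilityMeasure μ]
    (hR : IsCBER R) (hpmp : PreservesMeasure R μ) (haper : IsAperiodic R μ)
    (hm : IsEquivalentProbability μ m) : IsFSigmaDeltaHard.{u, v} (SubRelFin m) := by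
  intro Y _ _ hY B hB
  obtain ⟨C, hC, rfl⟩ := hB
  obtain ⟨t⟩ := exists_dyadicTower hR hpmp haper
  choose U hU hUC using fun n => exists_isClopen_finite_iff hY (hC n)
  have := hm.isProbabilityMeasure
  let f : Y → SubRel m := fun y => ⟨SeparationQuotient.mk (t.relSet m fun n i => y ∈ U n i),
    _, rfl, DyadicTower.isSubequivalence_relSet hR m _⟩
  refine ⟨f, (SeparationQuotient.continuous_mk.comp (continuous_relSet t hU)).subtype_mk _, ?_⟩
  ext y
  rw [mem_preimage, mem_subRelFin_iff hR hpmp hm (DyadicTower.isSubequivalence_relSet hR m _) rfl,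
    DyadicTower.ae_finite_relSet_iff hR hpmp, mem_iInter]
  exact forall_congr' fun n => (hUC n y).symm

end Hardness

theorem mainTheorem9 {X : Type u} [MeasurableSpace X] [StandardBorelSpace X]
    (μ : Measure X) [IsProbabilityMeasure μ] (R : Set (X × X))
    (hR : IsCBER R) (hpmp : PreservesMeasure R μ) (haper : IsAperiodic R μ) :
    (∃ m : Measure R, IsEquivalentProbability μ m) ∧
    ∀ m : Measure R, IsEquivalentProbability μ m →
      IsFSigmaDeltaComplete.{u, v} (SubRelFin m) :=
  ⟨exists_isEquivalentProbability hR, fun _ hm =>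
    ⟨isFSigmaDelta_subRelFin hR hpmp hm, isFSigmaDeltaHard_subRelFin hR hpmp haper hm⟩⟩
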